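/- Let $T$ be a complete first-order theory, $|T|$ the number of formulas of its language (at least $\aleph_0$), and let $\mathcal C\models T$ be a monster model: $\mathcal C$ is $\kappa$-saturated for some cardinal $\kappa>|T|^+$. A set is small if its cardinality is less than $\kappa$. All elements, finite tuples, sets of parameters and formulas are taken in $\mathcal C^{eq}$. A formula $\delta(x,a)$ strongly divides over $A$ if $tp(a/A)$ has infinitely many realizations and, for some $k\in\mathbb N$, the family $\{\delta(x,a')\}_{a'\models tp(a/A)}$ is $k$-inconsistent (any $k$ members with distinct parameters are jointly inconsistent). It þ-divides over $A$ if it strongly divides over $Ac$ for some finite tuple $c$. A formula þ-forks over $A$ if it implies a finite disjunction of formulas that þ-divide over $A$, and a type þ-forks over $A$ if one of its formulas does. For a formula $\phi(x)$ with parameters, a set $\Delta$ of formulas in $x;y$, a set $\Pi$ of formulas in $y;z$ ($x,y$ finite, $z$ possibly infinite) and $k\in\mathbb N$, the rank $\text{þ}(\phi,\Delta,\Pi,k)$ is defined by: it is $\ge 0$ iff $\phi$ is consistent; it is $\ge\lambda$, for a limit ordinal $\lambda$, iff it is $\ge\alpha$ for all $\alpha<\lambda$; it is $\ge\alpha+1$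 iff there are $\delta\in\Delta$, $\pi\in\Pi$ and parameters $c$ such that $\text{þ}(\phi\wedge\delta(x,a),\Delta,\Pi,k)\ge\alpha$ for infinitely many $a\models\pi(y;c)$ and $\{\delta(x,a)\}_{a\models\pi(y;c)}$ is $k$-inconsistent. The theory $T$ is rosy if all these ranks with $\Delta$ and $\Pi$ finite are defined, i.e. none of them is $\ge\alpha$ for all ordinals $\alpha$. Þ-forking satisfies local character if for every finite tuple $b$ and every small set $A$ there is $A_0\subseteq A$ with $|A_0|\le|T|$ such that $tp(b/A)$ does not þ-fork over $A_0$. Theorem. $T$ is rosy if and only if þ-forking satisfies local character. Moreover, $T$ is rosy if and only if all the ranks $\text{þ}(\phi,\Delta,\Pi,k)$ with $\Delta$ and $\Pi$ finite are smaller than $\omega$. -/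

import Mathlib

open FirstOrder FirstOrder.Language Cardinal

universe u v w x

namespace Thorn

/-- `M` is `κ`-saturated: every set of formulas in one variable, with parameters from a set of
fewer than `κ` elements, that is finitely satisfiable in `M` is realized in `M`. -/
def IsSaturated (L : FirstOrder.Language.{u, v}) (M : Type w) [L.Structure M] (κ : Cardinal.{w}) : Prop :=
  ∀ A : Set M, #A < κ → ∀ p : Set (L[[A]].Formula (Fin 1)),
    (∀ p₀ : Finset (L[[A]].Formula (Fin 1)), (p₀ : Set (L[[A]].Formula (Fin 1))) ⊆ p →
      ∃ e : Fin 1 → M, ∀ φ ∈ p₀, φ.Realize e) →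
    ∃ e : Fin 1 → M, ∀ φ ∈ p, φ.Realize e

/-- The cardinal `|T|` of a complete theory in the language `L` (the number of `L`-formulas). -/
noncomputable def theoryCard (L : FirstOrder.Language.{u, v}) : Cardinal.{max u v} := max ℵ₀ L.card

/-! ### The structure `M^eq` -/

/-- A sort of `M^eq`: an equivalence relation on some finite power of `M` which is definable
without parameters. -/
structure EqSort (L : FirstOrder.Language.{u, v}) (M : Type w) [L.Structure M] where
  arity : ℕ
  rel : L.Formula (Fin arity ⊕ Fin arity)
  equivalence : Equivalence fun a b : Fin arity → M => rel.Realize (Sum.elim a b)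

section

variable {L : FirstOrder.Language.{u, v}} {M : Type w} [L.Structure M]

/-- The equivalence relation underlying a sort. -/
def EqSort.setoid (s : EqSort L M) : Setoid (Fin s.arity → M) :=
  ⟨fun a b => s.rel.Realize (Sum.elim a b), s.equivalence⟩

/-- The elements of `M^eq` of sort `s`. -/
def EqSort.Elem (s : EqSort L M) : Type w := Quotient s.setoid

variable (L M) in
/-- All elements of `M^eq`, each with its sort. -/
abbrev Imaginary : Type (max u v w) := Σ s : EqSort L M, s.Elem

/-- Tuples of elements of `M^eq` of the sorts `σ`. -/
abbrev Tuple {ι : Type x} (σ : ι → EqSort L M) : Type (max w x) := ∀ i, (σ i).Elem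

/-- Variables of `L` for a tuple of representatives of a tuple of sorts `σ`. -/
abbrev RepVar {ι : Type x} (σ : ι → EqSort L M) : Type x := Σ i, Fin (σ i).arity

/-- The tuple of `M^eq` with the given representatives. -/
def mkTuple {ι : Type x} (σ : ι → EqSort L M) (r : RepVar σ → M) : Tuple σ :=
  fun i => Quotient.mk (σ i).setoid fun j => r ⟨i, j⟩

/-- A formula `φ(x; y)` of `L^eq` without parameters, with `x` of sorts `σ` and `y` of sorts `τ`.
It is given by an `L`-formula about representatives, and `φ(a; b)` says that some representatives
of `a` and `b` satisfy this `L`-formula. As the relations of `M^eq` that are definable without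
parameters are exactly the images of those of `M`, every formula of `L^eq` is of this
form up to equivalence. -/
def EqFormula {ι : Type} {ι' : Type} (σ : ι → EqSort L M) (τ : ι' → EqSort L M) : Type (max u v) :=
  L.Formula (RepVar σ ⊕ RepVar τ)

/-- `M^eq ⊨ φ(a; b)`. -/
def EqFormula.Holds {ι ι' : Type} {σ : ι → EqSort L M} {τ : ι' → EqSort L M}
    (φ : EqFormula σ τ) (a : Tuple σ) (b : Tuple τ) : Prop :=
  ∃ (r : RepVar σ → M) (r' : RepVar τ → M), mkTuple σ r = a ∧ mkTuple τ r' = b ∧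
    Formula.Realize (L := L) φ (Sum.elim r r')

/-- A formula `φ(x; d)` in the variables `x` of sorts `σ` with a finite tuple `d` of parameters
from `M^eq`. -/
structure ParamFormula {n : ℕ} (σ : Fin n → EqSort L M) where
  {len : ℕ}
  {sorts : Fin len → EqSort L M}
  formula : EqFormula σ sorts
  param : Tuple sorts

/-- The set of solutions of a formula with parameters. -/
def ParamFormula.solutions {n : ℕ} {σ : Fin n → EqSort L M} (φ : ParamFormula σ) :
    Set (Tuple σ) :=
  {a | φ.formula.Holds a φ.param}

/-- All parameters of the formula belong to `A`. -/
def ParamFormula.IsOver {n : ℕ} {σ : Fin n → EqSort L M} (φ : ParamFormula σ)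
    (A : Set (Imaginary L M)) : Prop :=
  ∀ j, (⟨φ.sorts j, φ.param j⟩ : Imaginary L M) ∈ A

/-- The complete type `tp(a/A)` of a finite tuple of `M^eq` over a subset of `M^eq`. -/
def tp {n : ℕ} {σ : Fin n → EqSort L M} (a : Tuple σ) (A : Set (Imaginary L M)) :
    Set (ParamFormula σ) :=
  {φ | φ.IsOver A ∧ a ∈ φ.solutions}

/-! ### Thorn-forking -/

/-- The family `{δ(x, a)}`, for `a` in `R`, is `k`-inconsistent. -/
def KInconsistent {n m : ℕ} {σ : Fin n → EqSort L M} {τ : Fin m → EqSort L M}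
    (δ : EqFormula σ τ) (R : Set (Tuple τ)) (k : ℕ) : Prop :=
  ∀ a : Fin k → Tuple τ, Function.Injective a → (∀ i, a i ∈ R) →
    ¬ ∃ b : Tuple σ, ∀ i, δ.Holds b (a i)

/-- `δ(x, a)` strongly divides over `A`: the type `tp(a/A)` is non-algebraic and the family of
the `δ(x, a')` with `a' ⊨ tp(a/A)` is `k`-inconsistent for some `k`. -/
def StronglyDivides {n : ℕ} {σ : Fin n → EqSort L M} (δ : ParamFormula σ)
    (A : Set (Imaginary L M)) : Prop :=
  {a' : Tuple δ.sorts | tp a' A = tp δ.param A}.Infinite ∧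
    ∃ k : ℕ, KInconsistent δ.formula {a' : Tuple δ.sorts | tp a' A = tp δ.param A} k

/-- `δ(x, a)` þ-divides over `A`: it strongly divides over `A c` for some finite tuple `c`. -/
def ThornDivides {n : ℕ} {σ : Fin n → EqSort L M} (δ : ParamFormula σ)
    (A : Set (Imaginary L M)) : Prop :=
  ∃ (m : ℕ) (c : Fin m → Imaginary L M), StronglyDivides δ (A ∪ Set.range c)

/-- `φ` þ-forks over `A`: it implies a finite disjunction of formulas þ-dividing over `A`. -/
def ThornForks {n : ℕ} {σ : Fin n → EqSort L M} (φ : ParamFormula σ)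
    (A : Set (Imaginary L M)) : Prop :=
  ∃ (m : ℕ) (ψ : Fin m → ParamFormula σ), (∀ i, ThornDivides (ψ i) A) ∧
    φ.solutions ⊆ ⋃ i, (ψ i).solutions

/-- A type þ-forks over `A` if one of its formulas does. -/
def TypeThornForks {n : ℕ} {σ : Fin n → EqSort L M} (p : Set (ParamFormula σ))
    (A : Set (Imaginary L M)) : Prop :=
  ∃ φ ∈ p, ThornForks φ A

variable (L M) in
/-- Local character of þ-forking, for `M` a `κ`-saturated model and small meaning of cardinality
less than `κ`: for every finite tuple `b` and every small set `A` in `M^eq` there is a subset `A₀`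
of `A` with at most `|T|` elements such that `tp(b/A)` does not þ-fork over `A₀`. -/
def HasLocalCharacter (κ : Cardinal.{w}) : Prop :=
  ∀ (n : ℕ) (σ : Fin n → EqSort L M) (b : Tuple σ) (A : Set (Imaginary L M)),
    #A < Cardinal.lift.{max u v} κ →
    ∃ A₀ ⊆ A, #A₀ ≤ Cardinal.lift.{w} (theoryCard L) ∧ ¬ TypeThornForks (tp b A) A₀

/-! ### Thorn-ranks -/

/-- `þ(D, Δ, Θ, k) ≥ α`, where `D` is the set of solutions of a formula in the variables `x` (of
sorts `σ`), `Δ` is a set of formulas in `x; y` and `Θ` a set of formulas in `y; z`, with `z`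
possibly infinite. -/
noncomputable def RankGE {n m : ℕ} {ι : Type} {σ : Fin n → EqSort L M} {τ : Fin m → EqSort L M}
    {ζ : ι → EqSort L M} (Δ : Set (EqFormula σ τ)) (Θ : Set (EqFormula τ ζ)) (k : ℕ)
    (α : Ordinal.{x}) : Set (Tuple σ) → Prop :=
  Ordinal.limitRecOn α
    (fun D => D.Nonempty)
    (fun _ ih D => ∃ δ ∈ Δ, ∃ π ∈ Θ, ∃ c : Tuple ζ,
      {a : Tuple τ | π.Holds a c ∧ ih (D ∩ {b | δ.Holds b a})}.Infinite ∧
      KInconsistent δ {a | π.Holds a c} k)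
    (fun l _ ih D => ∀ (β : Ordinal.{x}) (h : β < l), ih β h D)

section RankClauses

variable {n m : ℕ} {ι : Type} {σ : Fin n → EqSort L M} {τ : Fin m → EqSort L M}
  {ζ : ι → EqSort L M} (Δ : Set (EqFormula σ τ)) (Θ : Set (EqFormula τ ζ)) (k : ℕ)
  (D : Set (Tuple σ))

theorem rankGE_zero : RankGE Δ Θ k (0 : Ordinal.{x}) D ↔ D.Nonempty := by
  simp [RankGE]

theorem rankGE_succ (α : Ordinal.{x}) : RankGE Δ Θ k (α + 1) D ↔
    ∃ δ ∈ Δ, ∃ π ∈ Θ, ∃ c : Tuple ζ,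
      {a : Tuple τ | π.Holds a c ∧ RankGE Δ Θ k α (D ∩ {b | δ.Holds b a})}.Infinite ∧
      KInconsistent δ {a | π.Holds a c} k := by
  simp [RankGE]

theorem rankGE_limit {l : Ordinal.{x}} (hl : Order.IsSuccLimit l) :
    RankGE Δ Θ k l D ↔ ∀ α < l, RankGE Δ Θ k α D := by
  simp [RankGE, Ordinal.limitRecOn_limit, hl]

end RankClauses

variable (L M) in
/-- Rosiness: all þ-ranks `þ(φ, Δ, Θ, k)`, with `Δ` and `Θ` finite, are defined, that is, none
of them is `≥ α` for all ordinals `α`. -/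
def IsRosy : Prop :=
  ∀ (n m : ℕ) (ι : Type) (σ : Fin n → EqSort L M) (τ : Fin m → EqSort L M) (ζ : ι → EqSort L M)
    (φ : ParamFormula σ) (Δ : Set (EqFormula σ τ)) (Θ : Set (EqFormula τ ζ)) (k : ℕ),
    Δ.Finite → Θ.Finite → ∃ α : Ordinal.{w}, ¬ RankGE Δ Θ k α φ.solutions

variable (L M) in
/-- All þ-ranks `þ(φ, Δ, Θ, k)`, with `Δ` and `Θ` finite, are smaller than `ω`. -/
def AllRanksFinite : Prop :=
  ∀ (n m : ℕ) (ι : Type) (σ : Fin n → EqSort L M) (τ : Fin m → EqSort L M) (ζ : ι → EqSort L M)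
    (φ : ParamFormula σ) (Δ : Set (EqFormula σ τ)) (Θ : Set (EqFormula τ ζ)) (k : ℕ),
    Δ.Finite → Θ.Finite → ∃ N : ℕ, ¬ RankGE Δ Θ k (N : Ordinal.{w}) φ.solutions

end

end Thorn

/-!
Throughout, `M` is `κ`-saturated with `κ > |T|⁺`, and everything about `M^eq` is expressed by
predicates on valuations of representatives in `M` that are definable without parameters
(`DefPred`); parameters are kept as values of further variables. Saturation in one variable gives
compactness for fewer than `κ` variables over fewer than `κ` parameters
(`IsSaturated.exists_extension`).

*Rosiness and finite ranks.* For finite `Δ` and `Θ`, the condition that the rank of a definable set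
is at least `N` is type-definable in its parameters (`typeDefPred_rankGE`). If the rank is at least
every `N < ω`, then by compactness a single `δ`, `π`, `c` and a single infinite sequence witness
this for all `N` at once (`exists_uniform_witness`), and by induction the rank is at least every
ordinal (`rankGE_of_forall_nat`).

*Finite ranks imply local character.* Let `A₀` consist of the parameters of formulas `θ` of
`tp(b/A)` of minimal rank, one for each of the at most `|T|` many choices of `Δ`, `Θ` and `k`. If
`tp(b/A)` þ-forked over `A₀`, some formula in it would imply a disjunction of `ψ i (x, a i)` that
strongly divide over `A₀ c i`. By compactness each of these dividings is witnessed by a single formula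
(`exists_eqDefOver_kInconsistent`), and the finitely many formulas that occur are coded by one
choice of `Δ`, `Θ` and `k` (`exists_common_rank`). For the corresponding `θ`, of rank `N`, some
`θ ∧ ψ i (x, a i)` still has rank at least `N`; type-definability transfers this to all
realizations of the type of `a i` over `A₀ c i` (`rankGE_of_tp_eq`), so `θ` has rank at least
`N + 1`, a contradiction.

*Local character implies finite ranks.* If a rank is at least every `N < ω`, there are arbitrarily
long finite chains of formulas `δ(x, a i)` with a common solution `b`, where each `a i` is
non-algebraic over its predecessors and a tuple `c i`, and where `δ` and a formula over `c i` give a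
`k`-inconsistent family (`exists_finite_chain`). Compactness provides a chain of length `|T|⁺`
(`exists_chain`), and since `|T|⁺` is regular, `tp(b / {a i})` þ-forks over each subset of
cardinality at most `|T|`.
-/

namespace Thorn

/-! ### Predicates definable without parameters -/

section Definability

universe y z

variable {L : FirstOrder.Language.{u, v}} {M : Type w} [L.Structure M]

/-- Existential quantification over any set of variables preserves definability, because a formula
mentions only finitely many of them. -/
theorem definable_exists [Nonempty M] {A : Set M} {V : Type x} {W : Type y}
    {S : Set (V ⊕ W → M)} (h : A.Definable L S) :
    A.Definable L {v : V → M | ∃ w : W → M, Sum.elim v w ∈ S} := by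
  classical
  obtain ⟨φ, rfl⟩ := h
  let W₀ := {w : W // Sum.inr w ∈ BoundedFormula.freeVarFinset φ}
  have : Finite W₀ := Finite.of_injective
    (fun w : W₀ => (⟨Sum.inr w.1, w.2⟩ : BoundedFormula.freeVarFinset φ))
    fun a b hab => Subtype.ext (Sum.inr_injective (Subtype.ext_iff.1 hab))
  let f : BoundedFormula.freeVarFinset φ → V ⊕ W₀ := fun z =>
    match z with
    | ⟨Sum.inl a, _⟩ => Sum.inl a
    | ⟨Sum.inr b, hb⟩ => Sum.inr ⟨b, hb⟩
  let ψ : L[[A]].Formula (V ⊕ W₀) := BoundedFormula.restrictFreeVar φ f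
  have key : ∀ (v : V → M) (w : W → M) (w₀ : W₀ → M), (∀ b, w₀ b = w b.1) →
      (ψ.Realize (Sum.elim v w₀) ↔ φ.Realize (Sum.elim v w)) := by
    intro v w w₀ hw
    refine BoundedFormula.realize_restrictFreeVar (Sum.elim v w) ?_
    rintro ⟨a | b, hb⟩
    · rfl
    · exact hw ⟨b, hb⟩
  have h1 := Set.Definable.exists_of_finite (A := A) (L := L) (S := {u | ψ.Realize u}) ⟨ψ, rfl⟩
  convert h1 using 1
  ext v
  constructor
  · rintro ⟨w, hw⟩
    exact ⟨fun b => w b.1, (key v w _ fun _ => rfl).2 hw⟩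
  · rintro ⟨w₀, hw⟩
    refine ⟨fun b => if hb : Sum.inr b ∈ BoundedFormula.freeVarFinset φ then w₀ ⟨b, hb⟩
      else Classical.arbitrary M, (key v _ w₀ fun b => ?_).1 hw⟩
    simp [b.2]

variable (L) in
/-- The predicate `P` on valuations is given by an `L`-formula without parameters. -/
def DefPred {V : Type x} (P : (V → M) → Prop) : Prop :=
  (∅ : Set M).Definable L {v | P v}

section Closure

variable {V : Type x} {W : Type y}

theorem DefPred.of_formula (φ : L.Formula V) : DefPred (M := M) L fun v : V → M => φ.Realize v :=
  Set.empty_definable_iff.2 ⟨φ, rfl⟩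

theorem DefPred.exists_formula {P : (V → M) → Prop} (h : DefPred L P) :
    ∃ φ : L.Formula V, ∀ v, φ.Realize v ↔ P v := by
  obtain ⟨φ, hφ⟩ := Set.empty_definable_iff.1 h
  refine ⟨φ, fun v => ?_⟩
  have := Set.ext_iff.1 hφ v
  exact this.symm

/-- A definable predicate depends on the values of finitely many variables only. -/
theorem DefPred.exists_finset {P : (V → M) → Prop} (h : DefPred L P) :
    ∃ I : Finset V, ∀ v v', (∀ i ∈ I, v i = v' i) → P v → P v' := by
  classical
  obtain ⟨φ, hφ⟩ := h.exists_formula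
  refine ⟨BoundedFormula.freeVarFinset φ, fun v v' hv => ?_⟩
  rw [← hφ, ← hφ]
  have h1 := BoundedFormula.realize_restrictFreeVar (φ := φ) (f := fun z => z.1) (v := v)
    (xs := default) v fun _ => rfl
  have h2 := BoundedFormula.realize_restrictFreeVar (φ := φ) (f := fun z => z.1) (v := v)
    (xs := default) v' fun a => hv a.1 a.2
  exact fun h => h2.1 (h1.2 h)

theorem DefPred.congr {P Q : (V → M) → Prop} (h : DefPred L P) (hPQ : ∀ v, P v ↔ Q v) :
    DefPred L Q := by
  have : P = Q := funext fun v => propext (hPQ v)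
  exact this ▸ h

theorem DefPred.and {P Q : (V → M) → Prop} (hP : DefPred L P) (hQ : DefPred L Q) :
    DefPred L fun v => P v ∧ Q v :=
  Set.Definable.inter hP hQ

theorem DefPred.or {P Q : (V → M) → Prop} (hP : DefPred L P) (hQ : DefPred L Q) :
    DefPred L fun v => P v ∨ Q v :=
  Set.Definable.union hP hQ

theorem DefPred.not {P : (V → M) → Prop} (hP : DefPred L P) : DefPred L fun v => ¬ P v :=
  Set.Definable.compl hP

theorem DefPred.imp {P Q : (V → M) → Prop} (hP : DefPred L P) (hQ : DefPred L Q) :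
    DefPred L fun v => P v → Q v :=
  (hP.not.or hQ).congr fun _ => imp_iff_not_or.symm

theorem DefPred.const (p : Prop) : DefPred (M := M) (V := V) L fun _ => p := by
  by_cases hp : p
  · exact DefPred.congr (P := fun _ => True) Set.definable_univ (by simp [hp])
  · exact DefPred.congr (P := fun _ => False) Set.definable_empty (by simp [hp])

theorem DefPred.forall_finite {ι : Sort z} [Finite ι] {P : ι → (V → M) → Prop}
    (h : ∀ i, DefPred L (P i)) : DefPred L fun v => ∀ i, P i v := by
  have := Set.definable_iInter_of_finite (A := (∅ : Set M)) (L := L)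
    (f := fun i : PLift ι => {v | P i.down v}) fun i => h i.down
  refine DefPred.congr (P := fun v => v ∈ ⋂ i : PLift ι, {v | P i.down v}) this fun v => ?_
  simp [PLift.forall]

theorem DefPred.exists_finite {ι : Sort z} [Finite ι] {P : ι → (V → M) → Prop}
    (h : ∀ i, DefPred L (P i)) : DefPred L fun v => ∃ i, P i v :=
  (DefPred.forall_finite fun i => (h i).not).not.congr fun v => by simp

theorem DefPred.comp {P : (V → M) → Prop} (h : DefPred L P) (f : V → W) :
    DefPred L fun v : W → M => P fun i => v (f i) :=
  Set.Definable.preimage_comp f h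

theorem DefPred.exists [Nonempty M] {P : (V → M) → (W → M) → Prop}
    (h : DefPred L fun u : V ⊕ W → M => P (fun i => u (Sum.inl i)) fun i => u (Sum.inr i)) :
    DefPred L fun v => ∃ w, P v w :=
  definable_exists h

end Closure

/-! ### Definability in `M^eq` -/

theorem mkTuple_surjective {ι : Type x} (σ : ι → EqSort L M) :
    Function.Surjective (mkTuple σ) := by
  intro a
  choose r hr using fun i => Quotient.exists_rep (a i)
  exact ⟨fun p => r p.1 p.2, funext hr⟩

theorem mkTuple_apply_eq_iff {ι : Type x} {σ : ι → EqSort L M} (r r' : RepVar σ → M) (i : ι) :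
    mkTuple σ r i = mkTuple σ r' i ↔
      (σ i).rel.Realize (Sum.elim (fun j => r ⟨i, j⟩) fun j => r' ⟨i, j⟩) :=
  Quotient.eq (r := (σ i).setoid)

theorem defPred_mkTuple_apply_eq {V : Type y} {ι : Type x} {σ : ι → EqSort L M}
    (f g : RepVar σ → V) (i : ι) :
    DefPred L fun v : V → M =>
      mkTuple σ (fun p => v (f p)) i = mkTuple σ (fun p => v (g p)) i := by
  have := (DefPred.of_formula (M := M) (σ i).rel).comp
    (Sum.elim (fun j => f ⟨i, j⟩) fun j => g ⟨i, j⟩)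
  refine this.congr fun v => ?_
  rw [mkTuple_apply_eq_iff]
  apply iff_of_eq
  congr 1
  ext j
  cases j <;> rfl

theorem defPred_mkTuple_eq {V : Type y} {ι : Type x} [Finite ι] {σ : ι → EqSort L M}
    (f g : RepVar σ → V) :
    DefPred L fun v : V → M => mkTuple σ (fun p => v (f p)) = mkTuple σ (fun p => v (g p)) :=
  (DefPred.forall_finite fun i => defPred_mkTuple_apply_eq f g i).congr fun _ => funext_iff.symm

/-- A relation between tuples of `M^eq` whose pullback to representatives is definable. -/
def DefRel {ι ι' : Type} {σ : ι → EqSort L M} {τ : ι' → EqSort L M}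
    (P : Tuple σ → Tuple τ → Prop) : Prop :=
  DefPred L fun v : RepVar σ ⊕ RepVar τ → M =>
    P (mkTuple σ fun p => v (Sum.inl p)) (mkTuple τ fun p => v (Sum.inr p))

theorem DefRel.comp {V : Type y} {ι ι' : Type} {σ : ι → EqSort L M} {τ : ι' → EqSort L M}
    {P : Tuple σ → Tuple τ → Prop} (h : DefRel P) (f : RepVar σ → V) (g : RepVar τ → V) :
    DefPred L fun v : V → M => P (mkTuple σ fun p => v (f p)) (mkTuple τ fun p => v (g p)) :=
  DefPred.comp h (Sum.elim f g)

/-- Every relation between tuples of `M^eq` that is definable without parameters is given by an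
`EqFormula`. -/
theorem exists_eqFormula {ι ι' : Type} {σ : ι → EqSort L M} {τ : ι' → EqSort L M}
    {P : Tuple σ → Tuple τ → Prop} (h : DefRel P) :
    ∃ φ : EqFormula σ τ, ∀ a b, φ.Holds a b ↔ P a b := by
  obtain ⟨φ, hφ⟩ := DefPred.exists_formula h
  refine ⟨φ, fun a b => ⟨?_, fun hab => ?_⟩⟩
  · rintro ⟨r, r', rfl, rfl, h⟩
    exact (hφ _).1 h
  · obtain ⟨r, rfl⟩ := mkTuple_surjective σ a
    obtain ⟨r', rfl⟩ := mkTuple_surjective τ b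
    exact ⟨r, r', rfl, rfl, (hφ _).2 hab⟩

/-- A formula with infinitely many variables `z` depends on finitely many of them only. -/
theorem exists_finite_support {ι ι' : Type} [Finite ι] {σ : ι → EqSort L M}
    {ζ : ι' → EqSort L M} (φ : EqFormula σ ζ) :
    ∃ I : Finset ι', ∀ a c c', (∀ i ∈ I, c i = c' i) → φ.Holds a c → φ.Holds a c' := by
  classical
  obtain ⟨J, hJ⟩ := (DefPred.of_formula (M := M) (L := L) φ).exists_finset
  refine ⟨J.biUnion (Sum.elim (fun _ => ∅) fun p => {p.1}), ?_⟩
  rintro a c c' hc ⟨r, s, rfl, rfl, h⟩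
  obtain ⟨s', rfl⟩ := mkTuple_surjective ζ c'
  set I : Finset ι' := J.biUnion (Sum.elim (fun _ => ∅) fun p => {p.1})
  refine ⟨r, fun p => if p.1 ∈ I then s p else s' p, rfl, ?_, hJ _ _ ?_ h⟩
  · funext i
    by_cases hi : i ∈ I
    · rw [← hc i hi]
      simp only [mkTuple, hi, if_true]
      rfl
    · simp only [mkTuple, hi, if_false]
      rfl
  · rintro (p | p) hp
    · rfl
    · have : p.1 ∈ I := Finset.mem_biUnion.2 ⟨_, hp, by simp⟩
      simp [this]

variable [Nonempty M]

theorem defRel_holds {ι ι' : Type} [Finite ι] [Finite ι'] {σ : ι → EqSort L M}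
    {τ : ι' → EqSort L M} (φ : EqFormula σ τ) : DefRel φ.Holds := by
  unfold DefRel EqFormula.Holds
  refine DefPred.exists (DefPred.exists (DefPred.and ?_ (DefPred.and ?_ ?_)))
  · exact defPred_mkTuple_eq (fun p => Sum.inl (Sum.inr p)) (fun p => Sum.inl (Sum.inl (Sum.inl p)))
  · exact defPred_mkTuple_eq (fun p => Sum.inr p) (fun p => Sum.inl (Sum.inl (Sum.inr p)))
  · refine ((DefPred.of_formula (M := M) (L := L) φ).comp
      (Sum.elim (fun p => Sum.inl (Sum.inr p)) (fun p => Sum.inr p))).congr fun v => ?_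
    apply iff_of_eq
    congr 1
    ext j
    cases j <;> rfl

theorem defPred_kInconsistent {V : Type y} {n m l : ℕ} {σ : Fin n → EqSort L M}
    {τ : Fin m → EqSort L M} {ζ : Fin l → EqSort L M} (δ : EqFormula σ τ) (π : EqFormula τ ζ)
    (k : ℕ) (f : RepVar ζ → V) :
    DefPred L fun v : V → M =>
      KInconsistent δ {a | π.Holds a (mkTuple ζ fun p => v (f p))} k := by
  have : DefPred L fun v : V → M => ¬ ∃ s : Fin k × RepVar τ → M, ∃ r : RepVar σ → M,
      (∀ p : {p : Fin k × Fin k // p.1 ≠ p.2},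
        ¬ (mkTuple τ fun q => s (p.1.1, q)) = mkTuple τ fun q => s (p.1.2, q)) ∧
      ∀ i, π.Holds (mkTuple τ fun q => s (i, q)) (mkTuple ζ fun p => v (f p)) ∧
        δ.Holds (mkTuple σ fun q => r q) (mkTuple τ fun q => s (i, q)) := by
    refine (DefPred.exists (DefPred.exists (DefPred.and (DefPred.forall_finite fun p =>
      DefPred.not ?_) (DefPred.forall_finite fun i => DefPred.and ?_ ?_)))).not
    · exact defPred_mkTuple_eq (fun q => Sum.inl (Sum.inr (p.1.1, q)))
        (fun q => Sum.inl (Sum.inr (p.1.2, q)))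
    · exact (defRel_holds π).comp (fun q => Sum.inl (Sum.inr (i, q)))
        (fun q => Sum.inl (Sum.inl (f q)))
    · exact (defRel_holds δ).comp (fun q => Sum.inr q) (fun q => Sum.inl (Sum.inr (i, q)))
  refine this.congr fun v => ?_
  constructor
  · rintro h a ha haπ ⟨b, hb⟩
    refine h ?_
    choose s hs using fun i => mkTuple_surjective τ (a i)
    obtain ⟨r, rfl⟩ := mkTuple_surjective σ b
    refine ⟨fun q => s q.1 q.2, r, fun p hp => p.2 (ha ?_), fun i => ⟨?_, ?_⟩⟩
    · simpa only [hs] using hp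
    · rw [hs]
      exact haπ i
    · simpa only [hs] using hb i
  · rintro h ⟨s, r, hs, hsr⟩
    refine h (fun i => mkTuple τ fun q => s (i, q)) ?_ (fun i => (hsr i).1) ⟨_, fun i => (hsr i).2⟩
    intro i j hij
    by_contra hne
    exact hs ⟨(i, j), hne⟩ hij

end Definability


/-! ### Compactness in a saturated model -/

section Compactness

universe y z

variable {L : FirstOrder.Language.{u, v}} {M : Type w} [L.Structure M]

theorem DefPred.definable {V : Type x} {P : (V → M) → Prop} (h : DefPred L P) (A : Set M) :
    A.Definable L {v | P v} :=
  Set.Definable.mono h (Set.empty_subset A)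

variable [Nonempty M]

/-- A finitely satisfiable set of definable conditions on a valuation `u` of fewer than `κ`
variables, some of whose values are prescribed by `P₀`, is satisfiable. -/
theorem IsSaturated.exists_valuation {κ : Cardinal.{w}} (hM : IsSaturated L M κ)
    {U : Type x} (hU : Cardinal.lift.{w} #U < Cardinal.lift.{x} κ)
    {F : Set ((U → M) → Prop)} (hF : ∀ Q ∈ F, DefPred L Q) {P₀ : Set (U × M)}
    (h₀ : ∀ F₀ : Finset ((U → M) → Prop), (F₀ : Set _) ⊆ F →
      ∀ p : Finset (U × M), (p : Set _) ⊆ P₀ →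
      ∃ u : U → M, (∀ Q ∈ F₀, Q u) ∧ ∀ q ∈ p, u q.1 = q.2) :
    ∃ u : U → M, (∀ Q ∈ F, Q u) ∧ ∀ q ∈ P₀, u q.1 = q.2 := by
  classical
  let S : Set (Set (U × M)) := {P | ∀ F₀ : Finset ((U → M) → Prop), (F₀ : Set _) ⊆ F →
      ∀ p : Finset (U × M), (p : Set _) ⊆ P →
      ∃ u : U → M, (∀ Q ∈ F₀, Q u) ∧ ∀ q ∈ p, u q.1 = q.2}
  -- Extend the prescribed partial valuation to a maximal one that is finitely consistent with `F`.
  obtain ⟨P, hP₀, hP⟩ := zorn_subset_nonempty S (by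
    intro c hc hchain hne
    refine ⟨⋃₀ c, ?_, fun s hs => Set.subset_sUnion_of_mem hs⟩
    intro F₀ hF₀ p hp
    obtain ⟨s, hs, hps⟩ := DirectedOn.exists_mem_subset_of_finset_subset_biUnion hne
      (f := fun s : Set (U × M) => s) hchain.directedOn
      (by rwa [Set.sUnion_eq_biUnion] at hp)
    exact hc hs F₀ hF₀ p hps) P₀ h₀
  have hPS : P ∈ S := hP.prop
  have hfun : ∀ x m m', (x, m) ∈ P → (x, m') ∈ P → m = m' := by
    intro x m m' hm hm'
    obtain ⟨u, -, hu⟩ := hPS ∅ (by simp) {(x, m), (x, m')} (by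
      intro q hq
      simp only [Finset.coe_insert, Finset.coe_singleton, Set.mem_insert_iff,
        Set.mem_singleton_iff] at hq
      rcases hq with rfl | rfl <;> assumption)
    have h1 := hu (x, m) (by simp)
    have h2 := hu (x, m') (by simp)
    exact h1.symm.trans h2
  have htot : ∀ x, ∃ m, (x, m) ∈ P := by
    intro x
    let A : Set M := {m | ∃ x, (x, m) ∈ P}
    have hA : #A < κ := by
      have hcard : Cardinal.lift.{x} #A ≤ Cardinal.lift.{w} #U := by
        choose f hf using fun a : A => a.2
        exact Cardinal.lift_mk_le'.2 ⟨⟨f, fun a b hab =>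
          Subtype.ext (hfun _ _ _ (hf a) (hab ▸ hf b))⟩⟩
      exact Cardinal.lift_lt.1 (hcard.trans_lt hU)
    -- The values of `x` that are compatible with `F₀` and with `p`.
    let Z (F₀ : Finset ((U → M) → Prop)) (p : Finset (U × M)) : Set (Fin 1 → M) :=
      {e | ∃ u : U → M, (∀ Q ∈ F₀, Q u) ∧ (∀ q ∈ p, u q.1 = q.2) ∧ u x = e 0}
    have hZ : ∀ (F₀ : Finset _) (p : Finset _), (F₀ : Set _) ⊆ F → (p : Set _) ⊆ P →
        A.Definable L (Z F₀ p) := by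
      intro F₀ p hF₀ hp
      have h1 : A.Definable L {z : Fin 1 ⊕ U → M | (∀ Q ∈ F₀, Q fun y => z (Sum.inr y)) ∧
          (∀ q ∈ p, z (Sum.inr q.1) = q.2) ∧ z (Sum.inr x) = z (Sum.inl 0)} := by
        have hF₀' : DefPred L fun z : Fin 1 ⊕ U → M => ∀ Q : F₀, Q.1 fun y => z (Sum.inr y) :=
          DefPred.forall_finite fun Q => (hF Q.1 (hF₀ Q.2)).comp Sum.inr
        have hp' : A.Definable L (⋂ q : p, {z : Fin 1 ⊕ U → M | z (Sum.inr q.1.1) = q.1.2}) :=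
          Set.definable_iInter_of_finite fun q =>
            ⟨Term.equal (Term.var (Sum.inr q.1.1)) (L.con (⟨q.1.2, q.1.1, hp q.2⟩ : A)).term, by
              ext z
              simp [Formula.realize_equal]⟩
        have hx : A.Definable L {z : Fin 1 ⊕ U → M | z (Sum.inr x) = z (Sum.inl 0)} :=
          ⟨Term.equal (Term.var (Sum.inr x)) (Term.var (Sum.inl 0)), by
            ext z
            simp [Formula.realize_equal]⟩
        convert (hF₀'.definable A).inter (hp'.inter hx) using 1
        ext z
        simp
      exact definable_exists h1
    obtain ⟨e, he⟩ := hM A hA {ψ | ∃ (F₀ : Finset _) (p : Finset _), (F₀ : Set _) ⊆ F ∧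
        (p : Set _) ⊆ P ∧ ∀ e ∈ Z F₀ p, ψ.Realize e} (by
      intro p₀ hp₀
      choose! F₀ p hF₀ hp hψ using hp₀
      obtain ⟨u, hu, hu'⟩ := hPS (p₀.biUnion F₀) (by
        intro Q hQ
        obtain ⟨ψ, hψ, hQ⟩ := Finset.mem_biUnion.1 hQ
        exact hF₀ hψ hQ) (p₀.biUnion p) (by
        intro Q hQ
        obtain ⟨ψ, hψ, hQ⟩ := Finset.mem_biUnion.1 hQ
        exact hp hψ hQ)
      refine ⟨fun _ => u x, fun ψ hmem => hψ hmem _ ⟨u, fun Q hQ => ?_, fun q hq => ?_, rfl⟩⟩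
      · exact hu Q (Finset.mem_biUnion.2 ⟨ψ, hmem, hQ⟩)
      · exact hu' q (Finset.mem_biUnion.2 ⟨ψ, hmem, hq⟩))
    -- By maximality, the realization of all these conditions is already the value of `x` in `P`.
    refine ⟨e 0, ?_⟩
    refine hP.le_of_ge (y := insert (x, e 0) P) ?_ (Set.subset_insert _ _) (Set.mem_insert _ _)
    intro F₀ hF₀ p hp
    have hp' : ((p.erase (x, e 0) : Finset (U × M)) : Set (U × M)) ⊆ P := by
      intro q hq
      rw [Finset.mem_coe, Finset.mem_erase] at hq
      exact (hp hq.2).resolve_left hq.1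
    obtain ⟨ψ, hψ⟩ := hZ F₀ _ hF₀ hp'
    obtain ⟨u, hu, hu', hx⟩ : e ∈ Z F₀ (p.erase (x, e 0)) := by
      rw [hψ]
      exact he ψ ⟨F₀, _, hF₀, hp', fun e he => by rw [hψ] at he; exact he⟩
    refine ⟨u, hu, fun q hq => ?_⟩
    by_cases hqx : q = (x, e 0)
    · rw [hqx]
      exact hx
    · exact hu' q (Finset.mem_erase.2 ⟨hqx, hq⟩)
  choose u hu using htot
  refine ⟨u, fun Q hQ => ?_, fun q hq => hfun _ _ _ (hu q.1) (hP₀ hq)⟩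
  obtain ⟨I, hI⟩ := (hF Q hQ).exists_finset
  obtain ⟨u', hu', hI'⟩ := hPS {Q} (by simpa using hQ) (I.image fun x => (x, u x)) (by
    intro q hq
    obtain ⟨x, -, rfl⟩ := Finset.mem_image.1 hq
    exact hu x)
  exact hI u' u (fun x hx => hI' (x, u x) (Finset.mem_image_of_mem _ hx))
    (hu' Q (Finset.mem_singleton_self Q))

/-- Compactness with parameters: `v` is a valuation of the parameters, and the values of fewer than
`κ` further variables are sought. -/
theorem IsSaturated.exists_extension {κ : Cardinal.{w}} (hM : IsSaturated L M κ) (hκ : ℵ₀ ≤ κ)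
    {V : Type x} {W : Type y} (hV : Cardinal.lift.{w} #V < Cardinal.lift.{x} κ)
    (hW : Cardinal.lift.{w} #W < Cardinal.lift.{y} κ)
    {F : Set ((V ⊕ W → M) → Prop)} (hF : ∀ Q ∈ F, DefPred L Q) (v : V → M)
    (h₀ : ∀ F₀ : Finset ((V ⊕ W → M) → Prop), (F₀ : Set _) ⊆ F →
      ∃ w : W → M, ∀ Q ∈ F₀, Q (Sum.elim v w)) :
    ∃ w : W → M, ∀ Q ∈ F, Q (Sum.elim v w) := by
  have hU : Cardinal.lift.{w} #(V ⊕ W) < Cardinal.lift.{max x y} κ := by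
    rw [Cardinal.mk_sum, Cardinal.lift_add]
    refine Cardinal.add_lt_of_lt (by simpa using hκ) ?_ ?_
    · have := Cardinal.lift_lt.{max x w, y}.2 hV
      simpa using this
    · have := Cardinal.lift_lt.{max y w, x}.2 hW
      simpa using this
  obtain ⟨u, hu, hu'⟩ := hM.exists_valuation hU hF
    (P₀ := Set.range fun i => (Sum.inl i, v i)) (by
      intro F₀ hF₀ p hp
      obtain ⟨w, hw⟩ := h₀ F₀ hF₀
      refine ⟨_, hw, fun q hq => ?_⟩
      obtain ⟨i, rfl⟩ := hp hq
      rfl)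
  refine ⟨fun i => u (Sum.inr i), fun Q hQ => ?_⟩
  convert hu Q hQ using 1
  funext i
  rcases i with i | i
  · exact (hu' _ ⟨i, rfl⟩).symm
  · rfl

end Compactness


/-! ### Type-definable predicates -/

section TypeDefinability

universe y z

variable {L : FirstOrder.Language.{u, v}} {M : Type w} [L.Structure M]

variable (L) in
/-- The predicate `P` on valuations is a conjunction of predicates definable without parameters. -/
def TypeDefPred {V : Type x} (P : (V → M) → Prop) : Prop :=
  ∃ F : Set ((V → M) → Prop), (∀ Q ∈ F, DefPred L Q) ∧ ∀ v, P v ↔ ∀ Q ∈ F, Q v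

section Closure

variable {V : Type x} {W : Type y}

theorem DefPred.typeDefPred {P : (V → M) → Prop} (h : DefPred L P) : TypeDefPred L P :=
  ⟨{P}, by simpa using h, by simp⟩

theorem TypeDefPred.congr {P Q : (V → M) → Prop} (h : TypeDefPred L P) (hPQ : ∀ v, P v ↔ Q v) :
    TypeDefPred L Q := by
  have : P = Q := funext fun v => propext (hPQ v)
  exact this ▸ h

theorem TypeDefPred.forall {ι : Sort z} {P : ι → (V → M) → Prop}
    (h : ∀ i, TypeDefPred L (P i)) : TypeDefPred L fun v => ∀ i, P i v := by
  choose F hF hP using h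
  refine ⟨⋃ i, F i, fun Q hQ => ?_, fun v => ?_⟩
  · obtain ⟨i, hi⟩ := Set.mem_iUnion.1 hQ
    exact hF i Q hi
  · simp only [hP, Set.mem_iUnion]
    exact ⟨fun h Q ⟨i, hi⟩ => h i Q hi, fun h i Q hi => h Q ⟨i, hi⟩⟩

theorem TypeDefPred.and {P Q : (V → M) → Prop} (hP : TypeDefPred L P) (hQ : TypeDefPred L Q) :
    TypeDefPred L fun v => P v ∧ Q v :=
  (TypeDefPred.forall (P := fun b : Bool => if b then P else Q) fun b => by
    cases b
    · exact hQ
    · exact hP).congr fun v => by simp [and_comm]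

theorem TypeDefPred.exists_finite {ι : Type z} [Finite ι] {P : ι → (V → M) → Prop}
    (h : ∀ i, TypeDefPred L (P i)) : TypeDefPred L fun v => ∃ i, P i v := by
  choose F hF hP using h
  refine ⟨{Q | ∃ g : ∀ i, F i, Q = fun v => ∃ i, (g i).1 v}, ?_, fun v => ⟨?_, fun hv => ?_⟩⟩
  · rintro _ ⟨g, rfl⟩
    exact DefPred.exists_finite fun i => hF i _ (g i).2
  · rintro ⟨i, hi⟩ _ ⟨g, rfl⟩
    exact ⟨i, (hP i v).1 hi _ (g i).2⟩
  · by_contra hne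
    push Not at hne
    have : ∀ i, ∃ Q : F i, ¬ Q.1 v := by
      intro i
      have := hne i
      rw [hP] at this
      push Not at this
      obtain ⟨Q, hQ, hQv⟩ := this
      exact ⟨⟨Q, hQ⟩, hQv⟩
    choose g hg using this
    obtain ⟨i, hi⟩ := hv _ ⟨g, rfl⟩
    exact hg i hi

end Closure

variable [Nonempty M] {κ : Cardinal.{w}} {V : Type x} {W : Type y}

theorem lift_mk_lt_of_countable [Countable V] (hκ : ℵ₀ < κ) :
    Cardinal.lift.{w} #V < Cardinal.lift.{x} κ := by
  refine (Cardinal.lift_le.2 (Cardinal.mk_le_aleph0 (α := V))).trans_lt ?_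
  simpa using hκ

theorem TypeDefPred.exists [Countable V] [Countable W] (hM : IsSaturated L M κ) (hκ : ℵ₀ < κ)
    {P : (V → M) → (W → M) → Prop}
    (h : TypeDefPred L fun u : V ⊕ W → M =>
      P (fun i => u (Sum.inl i)) fun i => u (Sum.inr i)) :
    TypeDefPred L fun v => ∃ w, P v w := by
  obtain ⟨F, hF, hP⟩ := h
  refine ⟨{Q | ∃ F₀ : Finset ((V ⊕ W → M) → Prop), (F₀ : Set _) ⊆ F ∧
    Q = fun v => ∃ w : W → M, ∀ R ∈ F₀, R (Sum.elim v w)}, ?_, fun v => ⟨?_, fun hv => ?_⟩⟩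
  · rintro _ ⟨F₀, hF₀, rfl⟩
    refine DefPred.exists (P := fun v w => ∀ R ∈ F₀, R (Sum.elim v w)) ?_
    have : DefPred L fun u : V ⊕ W → M => ∀ R : F₀, R.1 u :=
      DefPred.forall_finite fun R => hF _ (hF₀ R.2)
    refine this.congr fun u => ?_
    have hu : (Sum.elim (fun i => u (Sum.inl i)) fun i => u (Sum.inr i)) = u := by
      ext i
      cases i <;> rfl
    simp [hu]
  · rintro ⟨w, hw⟩ _ ⟨F₀, hF₀, rfl⟩
    exact ⟨w, fun R hR => (hP (Sum.elim v w)).1 hw R (hF₀ hR)⟩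
  · obtain ⟨w, hw⟩ := hM.exists_extension hκ.le (lift_mk_lt_of_countable hκ)
      (lift_mk_lt_of_countable hκ) hF v fun F₀ hF₀ => hv _ ⟨F₀, hF₀, rfl⟩
    exact ⟨w, (hP (Sum.elim v w)).2 hw⟩

/-- A decreasing sequence of nonempty sets, type-definable over countably many parameters, has
nonempty intersection. -/
theorem exists_forall_of_antitone [Countable V] [Countable W] (hM : IsSaturated L M κ)
    (hκ : ℵ₀ < κ) {P : ℕ → (V ⊕ W → M) → Prop} (hP : ∀ N, TypeDefPred L (P N))
    (hanti : ∀ N u, P (N + 1) u → P N u) (v : V → M)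
    (h : ∀ N, ∃ w : W → M, P N (Sum.elim v w)) : ∃ w : W → M, ∀ N, P N (Sum.elim v w) := by
  classical
  choose F hF hPF using hP
  have hle : ∀ N N' u, N ≤ N' → P N' u → P N u := by
    intro N N' u hN
    induction hN with
    | refl => exact id
    | step _ ih => exact fun hu => ih (hanti _ _ hu)
  obtain ⟨w, hw⟩ := hM.exists_extension hκ.le (lift_mk_lt_of_countable hκ)
      (lift_mk_lt_of_countable hκ) (F := ⋃ N, F N) (fun Q hQ => by
        obtain ⟨i, hi⟩ := Set.mem_iUnion.1 hQ
        exact hF i Q hi) v (fun F₀ hF₀ => by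
        have : ∀ Q : F₀, ∃ N, Q.1 ∈ F N := fun Q => Set.mem_iUnion.1 (hF₀ Q.2)
        choose N hN using this
        obtain ⟨w, hw⟩ := h (Finset.univ.sup N)
        exact ⟨w, fun Q hQ => (hPF _ _).1
          (hle _ _ _ (Finset.le_sup (Finset.mem_univ (⟨Q, hQ⟩ : F₀))) hw) _ (hN ⟨Q, hQ⟩)⟩)
  exact ⟨w, fun N => (hPF N _).2 fun Q hQ => hw Q (Set.mem_iUnion.2 ⟨N, hQ⟩)⟩

end TypeDefinability

/-! ### Elementary properties of the ranks -/

section Rank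

variable {L : FirstOrder.Language.{u, v}} {M : Type w} [L.Structure M]

theorem KInconsistent.mono {n m k k' : ℕ} {σ : Fin n → EqSort L M} {τ : Fin m → EqSort L M}
    {δ : EqFormula σ τ} {R R' : Set (Tuple τ)} (h : KInconsistent δ R k) (hR : R' ⊆ R)
    (hk : k ≤ k') : KInconsistent δ R' k' := by
  rintro a ha haR ⟨b, hb⟩
  exact h (fun i => a (Fin.castLE hk i)) (ha.comp (Fin.castLE_injective hk))
    (fun i => hR (haR _)) ⟨b, fun i => hb _⟩

theorem infinite_iff_exists_reps {ι : Type} {τ : ι → EqSort L M} (S : Set (Tuple τ)) :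
    S.Infinite ↔ ∃ s : ℕ × RepVar τ → M,
      (∀ p : {p : ℕ × ℕ // p.1 ≠ p.2},
        ¬ (mkTuple τ fun q => s (p.1.1, q)) = mkTuple τ fun q => s (p.1.2, q)) ∧
      ∀ i, (mkTuple τ fun q => s (i, q)) ∈ S := by
  constructor
  · intro h
    choose s hs using fun i => mkTuple_surjective τ (h.natEmbedding S i).1
    refine ⟨fun p => s p.1 p.2, fun p hp => p.2 ?_, fun i => ?_⟩
    · simp only [hs] at hp
      exact (h.natEmbedding S).injective (Subtype.ext hp)
    · simp only [hs]
      exact (h.natEmbedding S i).2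
  · rintro ⟨s, hs, hS⟩
    refine Set.infinite_of_injective_forall_mem (f := fun i => mkTuple τ fun q => s (i, q)) ?_ hS
    intro i j hij
    by_contra hne
    exact hs ⟨(i, j), hne⟩ hij

theorem defPred_pairwise_ne {V : Type x} {ι I : Type} [Finite ι] {τ : ι → EqSort L M}
    (f : I → RepVar τ → V) (p : I × I) :
    DefPred L fun v : V → M =>
      ¬ (mkTuple τ fun q => v (f p.1 q)) = mkTuple τ fun q => v (f p.2 q) :=
  (defPred_mkTuple_eq (f p.1) (f p.2)).not

section

variable {n m : ℕ} {ι : Type} {σ : Fin n → EqSort L M} {τ : Fin m → EqSort L M}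
  {ζ : ι → EqSort L M} {Δ : Set (EqFormula σ τ)} {Θ : Set (EqFormula τ ζ)} {k : ℕ}

theorem rankGE_nat_succ {N : ℕ} {D : Set (Tuple σ)} :
    RankGE Δ Θ k ((N + 1 : ℕ) : Ordinal.{x}) D ↔
    ∃ δ ∈ Δ, ∃ π ∈ Θ, ∃ c : Tuple ζ,
      {a : Tuple τ | π.Holds a c ∧
        RankGE Δ Θ k (N : Ordinal.{x}) (D ∩ {b | δ.Holds b a})}.Infinite ∧
      KInconsistent δ {a | π.Holds a c} k := by
  rw [Nat.cast_succ]
  exact rankGE_succ Δ Θ k D _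

theorem rankGE_nat_zero {D : Set (Tuple σ)} :
    RankGE Δ Θ k ((0 : ℕ) : Ordinal.{x}) D ↔ D.Nonempty := by
  rw [Nat.cast_zero]
  exact rankGE_zero Δ Θ k D

theorem RankGE.mono {N : ℕ} {D D' : Set (Tuple σ)}
    (h : RankGE Δ Θ k (N : Ordinal.{x}) D) (hD : D ⊆ D') :
    RankGE Δ Θ k (N : Ordinal.{x}) D' := by
  induction N generalizing D D' with
  | zero => exact rankGE_nat_zero.2 ((rankGE_nat_zero.1 h).mono hD)
  | succ N ih =>
    obtain ⟨δ, hδ, π, hπ, c, hinf, hk⟩ := rankGE_nat_succ.1 h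
    exact rankGE_nat_succ.2 ⟨δ, hδ, π, hπ, c,
      hinf.mono fun a ha => ⟨ha.1, ih ha.2 (Set.inter_subset_inter_left _ hD)⟩, hk⟩

theorem RankGE.pred {N : ℕ} {D : Set (Tuple σ)}
    (h : RankGE Δ Θ k ((N + 1 : ℕ) : Ordinal.{x}) D) : RankGE Δ Θ k (N : Ordinal.{x}) D := by
  induction N generalizing D with
  | zero =>
    obtain ⟨δ, hδ, π, hπ, c, hinf, hk⟩ := rankGE_nat_succ.1 h
    obtain ⟨a, -, ha⟩ := hinf.nonempty
    exact ha.mono Set.inter_subset_left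
  | succ N ih =>
    obtain ⟨δ, hδ, π, hπ, c, hinf, hk⟩ := rankGE_nat_succ.1 h
    exact rankGE_nat_succ.2 ⟨δ, hδ, π, hπ, c, hinf.mono fun a ha => ⟨ha.1, ih ha.2⟩, hk⟩

theorem RankGE.of_le {N N' : ℕ} {D : Set (Tuple σ)}
    (h : RankGE Δ Θ k (N : Ordinal.{x}) D) (hN : N' ≤ N) : RankGE Δ Θ k (N' : Ordinal.{x}) D := by
  induction hN with
  | refl => exact h
  | step _ ih => exact ih h.pred

theorem RankGE.nonempty {N : ℕ} {D : Set (Tuple σ)}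
    (h : RankGE Δ Θ k (N : Ordinal.{x}) D) : D.Nonempty :=
  rankGE_nat_zero.1 (h.of_le (Nat.zero_le N))

theorem RankGE.union {N : ℕ} {D D' : Set (Tuple σ)}
    (h : RankGE Δ Θ k (N : Ordinal.{x}) (D ∪ D')) :
    RankGE Δ Θ k (N : Ordinal.{x}) D ∨ RankGE Δ Θ k (N : Ordinal.{x}) D' := by
  induction N generalizing D D' with
  | zero =>
    simp only [rankGE_nat_zero] at h ⊢
    exact Set.union_nonempty.1 h
  | succ N ih =>
    obtain ⟨δ, hδ, π, hπ, c, hinf, hk⟩ := rankGE_nat_succ.1 h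
    rw [rankGE_nat_succ, rankGE_nat_succ]
    have : ({a : Tuple τ | π.Holds a c ∧
        RankGE Δ Θ k (N : Ordinal.{x}) (D ∩ {b | δ.Holds b a})} ∪
        {a : Tuple τ | π.Holds a c ∧
        RankGE Δ Θ k (N : Ordinal.{x}) (D' ∩ {b | δ.Holds b a})}).Infinite := by
      refine hinf.mono fun a ha => ?_
      have h2 := ha.2
      rw [Set.union_inter_distrib_right] at h2
      exact (ih h2).imp (fun h => ⟨ha.1, h⟩) fun h => ⟨ha.1, h⟩
    rcases Set.infinite_union.1 this with h | h
    · exact Or.inl ⟨δ, hδ, π, hπ, c, h, hk⟩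
    · exact Or.inr ⟨δ, hδ, π, hπ, c, h, hk⟩

theorem RankGE.exists_of_iUnion {N p : ℕ} {D : Fin p → Set (Tuple σ)}
    (h : RankGE Δ Θ k (N : Ordinal.{x}) (⋃ i, D i)) :
    ∃ i, RankGE Δ Θ k (N : Ordinal.{x}) (D i) := by
  induction p with
  | zero =>
    obtain ⟨b, hb⟩ := h.nonempty
    simp at hb
  | succ p ih =>
    have : (⋃ i, D i) = D 0 ∪ ⋃ i : Fin p, D i.succ := by
      ext b
      simp [Fin.exists_fin_succ]
    rw [this] at h
    rcases h.union with h | h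
    · exact ⟨0, h⟩
    · obtain ⟨i, hi⟩ := ih h
      exact ⟨i.succ, hi⟩

end

/-! ### Type-definability of the ranks -/

section

variable {κ : Cardinal.{w}} {n m l : ℕ} {σ : Fin n → EqSort L M}
  {τ : Fin m → EqSort L M} {ζ : Fin l → EqSort L M} {Δ : Set (EqFormula σ τ)}
  {Θ : Set (EqFormula τ ζ)} {k : ℕ}

/-- A definable family of definable sets of tuples of `M^eq`, indexed by valuations. -/
def DefFamily {V : Type x} {n : ℕ} {σ : Fin n → EqSort L M} (D : (V → M) → Set (Tuple σ)) : Prop :=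
  DefPred L fun u : V ⊕ RepVar σ → M =>
    (mkTuple σ fun q => u (Sum.inr q)) ∈ D fun i => u (Sum.inl i)

/-- The condition on `c` and on a sequence `s` of representatives under which they witness that the
rank of `D` is at least `N + 1`. -/
def RankWitness (Δ : Set (EqFormula σ τ)) (Θ : Set (EqFormula τ ζ)) (k : ℕ)
    (δ : EqFormula σ τ) (π : EqFormula τ ζ) (N : ℕ) (D : Set (Tuple σ))
    (r : RepVar ζ → M) (s : ℕ × RepVar τ → M) : Prop :=
  KInconsistent δ {a | π.Holds a (mkTuple ζ fun q => r q)} k ∧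
  (∀ p : {p : ℕ × ℕ // p.1 ≠ p.2},
    ¬ (mkTuple τ fun q => s (p.1.1, q)) = mkTuple τ fun q => s (p.1.2, q)) ∧
  ∀ i, π.Holds (mkTuple τ fun q => s (i, q)) (mkTuple ζ fun q => r q) ∧
    RankGE Δ Θ k (N : Ordinal.{w}) (D ∩ {b | δ.Holds b (mkTuple τ fun q => s (i, q))})

theorem rankGE_nat_succ_iff_exists_witness {N : ℕ} {D : Set (Tuple σ)} :
    RankGE Δ Θ k ((N + 1 : ℕ) : Ordinal.{w}) D ↔
    ∃ (δ : Δ) (π : Θ), ∃ (t : RepVar ζ ⊕ ℕ × RepVar τ → M),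
      RankWitness Δ Θ k δ.1 π.1 N D (fun i => t (Sum.inl i)) (fun i => t (Sum.inr i)) := by
  rw [rankGE_nat_succ]
  constructor
  · rintro ⟨δ, hδ, π, hπ, c, hinf, hk⟩
    obtain ⟨s, hs, hs'⟩ := (infinite_iff_exists_reps _).1 hinf
    obtain ⟨r, rfl⟩ := mkTuple_surjective ζ c
    exact ⟨⟨δ, hδ⟩, ⟨π, hπ⟩, Sum.elim r s, hk, hs, hs'⟩
  · rintro ⟨δ, π, t, hk, hs, hs'⟩
    exact ⟨δ.1, δ.2, π.1, π.2, mkTuple ζ fun q => t (Sum.inl q),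
      (infinite_iff_exists_reps _).2 ⟨fun i => t (Sum.inr i), hs, hs'⟩, hk⟩

variable [Nonempty M]

theorem DefFamily.inter_holds {V W : Type} {D : (V → M) → Set (Tuple σ)} (hD : DefFamily D)
    (δ : EqFormula σ τ) (f : V → W) (g : RepVar τ → W) :
    DefFamily fun v : W → M =>
      D (fun i => v (f i)) ∩ {b | δ.Holds b (mkTuple τ fun q => v (g q))} := by
  refine DefPred.and ?_ ?_
  · exact DefPred.comp hD (Sum.elim (fun i => Sum.inl (f i)) Sum.inr)
  · exact (defRel_holds δ).comp (fun q => Sum.inr q) (fun q => Sum.inl (g q))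

theorem typeDefPred_rankWitness {N : ℕ}
    (ih : ∀ {V : Type} [Countable V] {D : (V → M) → Set (Tuple σ)}, DefFamily D →
      TypeDefPred L fun v => RankGE Δ Θ k (N : Ordinal.{w}) (D v))
    {V W : Type} [Countable W] {D : (V → M) → Set (Tuple σ)} (hD : DefFamily D)
    (δ : EqFormula σ τ) (π : EqFormula τ ζ) (f : V → W) (g : RepVar ζ → W)
    (h : ℕ × RepVar τ → W) :
    TypeDefPred L fun v : W → M => RankWitness Δ Θ k δ π N (D fun i => v (f i))
      (fun i => v (g i)) (fun i => v (h i)) := by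
  refine TypeDefPred.and ?_ (TypeDefPred.and ?_ ?_)
  · exact (defPred_kInconsistent δ π k g).typeDefPred
  · exact TypeDefPred.forall fun p =>
      (defPred_pairwise_ne (fun i q => h (i, q)) p.1).typeDefPred
  · refine TypeDefPred.forall fun i => TypeDefPred.and ?_ ?_
    · exact ((defRel_holds π).comp (fun q => h (i, q)) g).typeDefPred
    · exact ih (hD.inter_holds δ f fun q => h (i, q))

/-- The rank of a definable family being at least `N` is a type-definable condition. -/
theorem typeDefPred_rankGE (hM : IsSaturated L M κ) (hκ : ℵ₀ < κ) (hΔ : Δ.Finite) (hΘ : Θ.Finite)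
    (N : ℕ) {V : Type} [Countable V] {D : (V → M) → Set (Tuple σ)} (hD : DefFamily D) :
    TypeDefPred L fun v => RankGE Δ Θ k (N : Ordinal.{w}) (D v) := by
  have := hΔ.to_subtype
  have := hΘ.to_subtype
  induction N generalizing V with
  | zero =>
    have : DefPred L fun v => ∃ r : RepVar σ → M, (mkTuple σ fun q => r q) ∈ D v :=
      DefPred.exists hD
    refine (this.congr fun v => ?_).typeDefPred
    rw [rankGE_nat_zero]
    constructor
    · rintro ⟨r, hr⟩
      exact ⟨_, hr⟩
    · rintro ⟨b, hb⟩
      obtain ⟨r, rfl⟩ := mkTuple_surjective σ b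
      exact ⟨r, hb⟩
  | succ N ih =>
    simp only [rankGE_nat_succ_iff_exists_witness]
    refine TypeDefPred.exists_finite fun δ => TypeDefPred.exists_finite fun π =>
      TypeDefPred.exists hM hκ ?_
    exact typeDefPred_rankWitness ih hD δ.1 π.1 Sum.inl (fun i => Sum.inr (Sum.inl i))
      (fun i => Sum.inr (Sum.inr i))

/-- If the rank of `D` is at least every `N < ω`, then a single `δ`, a single `π` and a single
tuple `c` witness this for all `N` simultaneously. -/
theorem exists_uniform_witness (hM : IsSaturated L M κ) (hκ : ℵ₀ < κ) (hΔ : Δ.Finite)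
    (hΘ : Θ.Finite) {V : Type} [Countable V] {D : (V → M) → Set (Tuple σ)} (hD : DefFamily D)
    (v : V → M) (h : ∀ N : ℕ, RankGE Δ Θ k (N : Ordinal.{w}) (D v)) :
    ∃ (δ : Δ) (π : Θ) (t : RepVar ζ ⊕ ℕ × RepVar τ → M), ∀ N,
      RankWitness Δ Θ k δ.1 π.1 N (D v) (fun i => t (Sum.inl i)) (fun i => t (Sum.inr i)) := by
  have := hΔ.to_subtype
  have := hΘ.to_subtype
  have hmono : ∀ N (δ : EqFormula σ τ) π D' r s,
      RankWitness Δ Θ k δ π (N + 1) D' r s → RankWitness Δ Θ k δ π N D' r s :=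
    fun N δ π D' r s hw => ⟨hw.1, hw.2.1, fun i => ⟨(hw.2.2 i).1, (hw.2.2 i).2.pred⟩⟩
  have hmono' : ∀ {N N'} (δ : EqFormula σ τ) π D' r s, N ≤ N' →
      RankWitness Δ Θ k δ π N' D' r s → RankWitness Δ Θ k δ π N D' r s := by
    intro N N' δ π D' r s hN
    induction hN with
    | refl => exact id
    | step _ ih => exact fun hu => ih (hmono _ _ _ _ _ _ hu)
  choose δ π t ht using fun N => rankGE_nat_succ_iff_exists_witness.1 (h (N + 1))
  -- Some pair `(δ, π)` works for infinitely many `N`, hence for all `N` by monotonicity.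
  obtain ⟨⟨δ₀, π₀⟩, hinf⟩ := Finite.exists_infinite_fiber fun N => (δ N, π N)
  rw [Set.infinite_coe_iff] at hinf
  refine ⟨δ₀, π₀, exists_forall_of_antitone hM hκ (V := V) (W := RepVar ζ ⊕ ℕ × RepVar τ)
    (P := fun N u => RankWitness Δ Θ k δ₀.1 π₀.1 N (D fun i => u (Sum.inl i))
      (fun i => u (Sum.inr (Sum.inl i))) (fun i => u (Sum.inr (Sum.inr i)))) (fun N => ?_)
    (fun N u => hmono N _ _ _ _ _) v fun N => ?_⟩
  · exact typeDefPred_rankWitness (fun hD => typeDefPred_rankGE hM hκ hΔ hΘ N hD) hD δ₀.1 π₀.1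
      Sum.inl (fun i => Sum.inr (Sum.inl i)) (fun i => Sum.inr (Sum.inr i))
  · obtain ⟨N', hN', hNN'⟩ := hinf.exists_gt N
    refine ⟨t N', ?_⟩
    have h1 := ht N'
    obtain ⟨e1, e2⟩ := Prod.mk.inj (show (δ N', π N') = (δ₀, π₀) from hN')
    rw [e1, e2] at h1
    exact hmono' _ _ _ _ _ hNN'.le h1

/-- A rank that is not smaller than `ω` is not defined. -/
theorem rankGE_of_forall_nat (hM : IsSaturated L M κ) (hκ : ℵ₀ < κ) (hΔ : Δ.Finite)
    (hΘ : Θ.Finite) (α : Ordinal.{w}) {V : Type} [Countable V] {D : (V → M) → Set (Tuple σ)}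
    (hD : DefFamily D) (v : V → M) (h : ∀ N : ℕ, RankGE Δ Θ k (N : Ordinal.{w}) (D v)) :
    RankGE Δ Θ k α (D v) := by
  induction α using Ordinal.limitRecOn generalizing V with
  | zero => exact (rankGE_zero Δ Θ k _).2 (h 0).nonempty
  | add_one α ih =>
    obtain ⟨δ, π, t, ht⟩ := exists_uniform_witness hM hκ hΔ hΘ hD v h
    refine (rankGE_succ Δ Θ k _ α).2 ⟨δ.1, δ.2, π.1, π.2, _,
      (infinite_iff_exists_reps _).2 ⟨fun i => t (Sum.inr i), (ht 0).2.1, fun i => ?_⟩, (ht 0).1⟩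
    refine ⟨((ht 0).2.2 i).1, ?_⟩
    exact ih (hD.inter_holds δ.1 Sum.inl Sum.inr)
      (Sum.elim v fun q => t (Sum.inr (i, q))) fun N => ((ht N).2.2 i).2
  | limit l hl ih =>
    exact (rankGE_limit Δ Θ k _ hl).2 fun β hβ => ih β hβ hD v h

theorem ParamFormula.exists_defFamily (φ : ParamFormula σ) :
    ∃ (V : Type) (_ : Countable V) (D : (V → M) → Set (Tuple σ)) (v : V → M),
      DefFamily D ∧ D v = φ.solutions := by
  obtain ⟨r, hr⟩ := mkTuple_surjective φ.sorts φ.param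
  refine ⟨RepVar φ.sorts, inferInstance,
    fun r => {b | φ.formula.Holds b (mkTuple _ fun q => r q)}, r, ?_, ?_⟩
  · exact (defRel_holds φ.formula).comp (fun q => Sum.inr q) (fun q => Sum.inl q)
  · show {b | φ.formula.Holds b (mkTuple φ.sorts r)} = φ.solutions
    rw [hr]
    rfl

end

/-! ### Reduction to finitely many parameter variables -/

section

variable {n m : ℕ} {ι : Type} {σ : Fin n → EqSort L M} {τ : Fin m → EqSort L M}
  {ζ : ι → EqSort L M} {Δ : Set (EqFormula σ τ)} {Θ : Set (EqFormula τ ζ)} {k : ℕ}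

theorem RankGE.of_reduction {l : ℕ} {e : Fin l → ι} {Θ' : Set (EqFormula τ fun t => ζ (e t))}
    (h : ∀ π ∈ Θ, ∃ π' ∈ Θ', ∀ a c, π'.Holds a (fun t => c (e t)) ↔ π.Holds a c)
    {N : ℕ} {D : Set (Tuple σ)} (hD : RankGE Δ Θ k (N : Ordinal.{x}) D) :
    RankGE Δ Θ' k (N : Ordinal.{x}) D := by
  induction N generalizing D with
  | zero => exact rankGE_nat_zero.2 hD.nonempty
  | succ N ih =>
    obtain ⟨δ, hδ, π, hπ, c, hinf, hk⟩ := rankGE_nat_succ.1 hD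
    obtain ⟨π', hπ', heq⟩ := h π hπ
    refine rankGE_nat_succ.2 ⟨δ, hδ, π', hπ', fun t => c (e t), ?_, ?_⟩
    · exact hinf.mono fun a ha => ⟨(heq a c).2 ha.1, ih ha.2⟩
    · exact hk.mono (fun a ha => (heq a c).1 ha) le_rfl

variable [Nonempty M]

/-- A formula depending only on the variables `e t` is equivalent to a formula in these. -/
theorem exists_eqFormula_of_support (π : EqFormula τ ζ) {l : ℕ} (e : Fin l → ι)
    (he : ∀ a c c', (∀ t, c (e t) = c' (e t)) → π.Holds a c → π.Holds a c') :
    ∃ π' : EqFormula τ (fun t => ζ (e t)), ∀ a c, π'.Holds a (fun t => c (e t)) ↔ π.Holds a c := by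
  obtain ⟨π', hπ'⟩ := exists_eqFormula (σ := τ) (τ := fun t => ζ (e t))
    (P := fun a c' => ∃ c : Tuple ζ, (∀ t, c (e t) = c' t) ∧ π.Holds a c) (by
    have : DefPred L fun v : RepVar τ ⊕ RepVar (fun t => ζ (e t)) → M =>
        ∃ u : RepVar τ ⊕ RepVar ζ → M, Formula.Realize (L := L) π u ∧
          (mkTuple τ fun q => u (Sum.inl q)) = (mkTuple τ fun q => v (Sum.inl q)) ∧
          (mkTuple (fun t => ζ (e t)) fun q => u (Sum.inr ⟨e q.1, q.2⟩)) =
            mkTuple (fun t => ζ (e t)) fun q => v (Sum.inr q) := by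
      refine DefPred.exists (DefPred.and ?_ (DefPred.and ?_ ?_))
      · exact (DefPred.of_formula (M := M) (L := L) π).comp Sum.inr
      · exact defPred_mkTuple_eq (fun q => Sum.inr (Sum.inl q)) (fun q => Sum.inl (Sum.inl q))
      · exact defPred_mkTuple_eq (σ := fun t => ζ (e t))
          (fun q : RepVar fun t => ζ (e t) => Sum.inr (Sum.inr (⟨e q.1, q.2⟩ : RepVar ζ)))
          (fun q => Sum.inl (Sum.inr q))
    refine this.congr fun v => ?_
    constructor
    · rintro ⟨u, hu, h1, h2⟩
      refine ⟨mkTuple ζ fun q => u (Sum.inr q), fun t => congrFun h2 t, _, _, h1, rfl, ?_⟩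
      convert hu using 1
      ext q
      cases q <;> rfl
    · rintro ⟨c, hc, r, r', h1, rfl, h⟩
      exact ⟨Sum.elim r r', h, h1, funext hc⟩)
  refine ⟨π', fun a c => ?_⟩
  rw [hπ']
  constructor
  · rintro ⟨c', hc', h⟩
    exact he a c' c hc' h
  · exact fun h => ⟨c, fun _ => rfl, h⟩

/-- For finite `Θ`, the possibly infinite tuple of variables `z` may be replaced by a finite one. -/
theorem exists_finite_reduction (hΘ : Θ.Finite) :
    ∃ (l : ℕ) (e : Fin l → ι) (Θ' : Set (EqFormula τ fun t => ζ (e t))), Θ'.Finite ∧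
      ∀ π ∈ Θ, ∃ π' ∈ Θ', ∀ a c, π'.Holds a (fun t => c (e t)) ↔ π.Holds a c := by
  classical
  choose I hI using fun π : EqFormula τ ζ => exists_finite_support π
  let J := hΘ.toFinset.biUnion I
  let e : Fin J.card → ι := fun t => (J.equivFin.symm t).1
  have hJ : ∀ π ∈ Θ, ∃ π' : EqFormula τ (fun t => ζ (e t)),
      ∀ a c, π'.Holds a (fun t => c (e t)) ↔ π.Holds a c := by
    intro π hπ
    refine exists_eqFormula_of_support π e fun a c c' hc => hI π a c c' fun i hi => ?_
    have hiJ : i ∈ J := Finset.mem_biUnion.2 ⟨π, hΘ.mem_toFinset.2 hπ, hi⟩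
    have := hc (J.equivFin ⟨i, hiJ⟩)
    have hei : e (J.equivFin ⟨i, hiJ⟩) = i := by simp [e]
    rwa [hei] at this
  choose f hf using hJ
  have := hΘ.to_subtype
  exact ⟨_, e, Set.range fun π : Θ => f π.1 π.2, Set.finite_range _,
    fun π hπ => ⟨_, ⟨⟨π, hπ⟩, rfl⟩, hf π hπ⟩⟩

end

theorem isRosy_of_allRanksFinite (h : AllRanksFinite L M) : IsRosy L M := by
  intro n m ι σ τ ζ φ Δ Θ k hΔ hΘ
  obtain ⟨N, hN⟩ := h n m ι σ τ ζ φ Δ Θ k hΔ hΘ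
  exact ⟨N, hN⟩

theorem allRanksFinite_of_isRosy [Nonempty M] {κ : Cardinal.{w}} (hM : IsSaturated L M κ)
    (hκ : ℵ₀ < κ) (h : IsRosy L M) : AllRanksFinite L M := by
  intro n m ι σ τ ζ φ Δ Θ k hΔ hΘ
  by_contra hne
  push Not at hne
  obtain ⟨l, e, Θ', hΘ', hred⟩ := exists_finite_reduction hΘ
  obtain ⟨V, _, D, v, hD, hDv⟩ := φ.exists_defFamily
  obtain ⟨α, hα⟩ := h n m (Fin l) σ τ _ φ Δ Θ' k hΔ hΘ'
  refine hα ?_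
  rw [← hDv] at hne ⊢
  exact rankGE_of_forall_nat hM hκ hΔ hΘ' α hD v fun N => (hne N).of_reduction hred

end Rank


/-! ### Types over subsets of `M^eq` -/

section Types

universe y z

variable {L : FirstOrder.Language.{u, v}} {M : Type w} [L.Structure M]

/-- Tuples indexed by `α` and tuples indexed by `β` are the same for equivalent `α` and `β`. -/
def reindexTuple {α β : Type} (e : α ≃ β) (υ : β → EqSort L M) :
    Tuple (fun t => υ (e t)) ≃ Tuple υ :=
  Equiv.piCongrLeft (fun j => (υ j).Elem) e

theorem reindexTuple_apply {α β : Type} (e : α ≃ β) (υ : β → EqSort L M) (d : Tuple υ) :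
    reindexTuple e υ (fun t => d (e t)) = d := by
  rw [← Equiv.eq_symm_apply]
  rfl

theorem reindexTuple_mkTuple {α β : Type} (e : α ≃ β) (υ : β → EqSort L M)
    (r : RepVar (fun t => υ (e t)) → M) :
    reindexTuple e υ (mkTuple _ r) =
      mkTuple υ fun q => r ((Equiv.sigmaCongrLeft (β := fun j => Fin (υ j).arity) e).symm q) := by
  rw [← Equiv.eq_symm_apply]
  funext t
  have h : ∀ j, (Equiv.sigmaCongrLeft (β := fun j => Fin (υ j).arity) e).symm ⟨e t, j⟩ = ⟨t, j⟩ :=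
    fun j => (Equiv.symm_apply_eq _).2 rfl
  show mkTuple _ r t = mkTuple υ (fun q => r _) (e t)
  simp only [mkTuple, h]
  rfl

/-- A set of tuples of `M^eq` defined by a formula with parameters in `B`. -/
def EqDefOver (B : Set (Imaginary L M)) {n : ℕ} {σ : Fin n → EqSort L M} (S : Set (Tuple σ)) :
    Prop :=
  ∃ χ : ParamFormula σ, χ.IsOver B ∧ χ.solutions = S

variable {n : ℕ} {σ : Fin n → EqSort L M} {B : Set (Imaginary L M)}

/-- The parameters may be indexed by any finite type. -/
theorem eqDefOver_of_defRel {J : Type} [Finite J] {υ : J → EqSort L M}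
    {P : Tuple σ → Tuple υ → Prop} (h : DefRel P) (d : Tuple υ)
    (hd : ∀ j, (⟨υ j, d j⟩ : Imaginary L M) ∈ B) : EqDefOver B {a | P a d} := by
  obtain ⟨l, ⟨e'⟩⟩ := Finite.exists_equiv_fin J
  let e := e'.symm
  obtain ⟨φ, hφ⟩ := exists_eqFormula (σ := σ) (τ := fun t => υ (e t))
    (P := fun a b => P a (reindexTuple e υ b)) (by
      unfold DefRel
      simp only [reindexTuple_mkTuple]
      exact h.comp (fun q => Sum.inl q) (fun q => Sum.inr _))
  refine ⟨⟨φ, fun t => d (e t)⟩, fun t => hd (e t), ?_⟩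
  ext a
  show φ.Holds a _ ↔ P a d
  rw [hφ, reindexTuple_apply]

theorem mem_tp {a : Tuple σ} {χ : ParamFormula σ} :
    χ ∈ tp a B ↔ χ.IsOver B ∧ a ∈ χ.solutions :=
  Iff.rfl

theorem eqDefOver_univ : EqDefOver B (Set.univ : Set (Tuple σ)) :=
  eqDefOver_of_defRel (J := Empty) (υ := fun e => e.elim) (P := fun _ _ => True)
    (DefPred.const True) (fun e => e.elim) (fun e => e.elim)

/-- Variables for representatives of all elements of `B`. -/
abbrev ParamVar (B : Set (Imaginary L M)) : Type (max u v w) := Σ x : B, Fin x.1.1.arity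

/-- A choice of representatives of all elements of `B`. -/
noncomputable def paramRep (B : Set (Imaginary L M)) : ParamVar B → M :=
  fun p => Quotient.out (s := p.1.1.1.setoid) p.1.1.2 p.2

variable {κ : Cardinal.{w}}

theorem lift_mk_paramVar_lt (hκ : ℵ₀ < κ) (hB : #B < Cardinal.lift.{max u v} κ) :
    Cardinal.lift.{w} #(ParamVar B) < Cardinal.lift.{max u v w} κ := by
  have h1 : #(ParamVar B) ≤ #B * ℵ₀ := by
    rw [Cardinal.mk_sigma]
    refine (Cardinal.sum_le_sum _ (fun _ => ℵ₀) fun x => ?_).trans ?_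
    · exact Cardinal.mk_le_aleph0
    · simp
  have h2 : #(ParamVar B) < Cardinal.lift.{max u v} κ := by
    have hκ' : ℵ₀ < Cardinal.lift.{max u v} κ := by simpa using hκ
    exact h1.trans_lt (Cardinal.mul_lt_of_lt hκ'.le hB hκ')
  have h3 : Cardinal.lift.{max u v w} κ = Cardinal.lift.{max u v} κ := by
    rw [Cardinal.lift_umax.{w, max u v}]
  rw [h3, Cardinal.lift_id'.{w, max u v w}]
  exact h2

variable [Nonempty M]

theorem ParamFormula.defRel (χ : ParamFormula σ) : DefRel χ.formula.Holds :=
  defRel_holds χ.formula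

theorem EqDefOver.inter {S S' : Set (Tuple σ)} (h : EqDefOver B S) (h' : EqDefOver B S') :
    EqDefOver B (S ∩ S') := by
  obtain ⟨χ, hχ, rfl⟩ := h
  obtain ⟨χ', hχ', rfl⟩ := h'
  refine eqDefOver_of_defRel (υ := Sum.elim χ.sorts χ'.sorts)
    (P := fun a d => χ.formula.Holds a (fun j => d (Sum.inl j)) ∧
      χ'.formula.Holds a fun j => d (Sum.inr j)) ?_
    (fun j => Sum.rec (motive := fun j => (Sum.elim χ.sorts χ'.sorts j).Elem)
      χ.param χ'.param j) ?_
  · exact DefPred.and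
      (χ.defRel.comp (fun q => Sum.inl q)
        (fun q => Sum.inr (⟨Sum.inl q.1, q.2⟩ : RepVar (Sum.elim χ.sorts χ'.sorts))))
      (χ'.defRel.comp (fun q => Sum.inl q)
        (fun q => Sum.inr (⟨Sum.inr q.1, q.2⟩ : RepVar (Sum.elim χ.sorts χ'.sorts))))
  · rintro (j | j)
    · exact hχ j
    · exact hχ' j

theorem EqDefOver.compl {S : Set (Tuple σ)} (h : EqDefOver B S) : EqDefOver B Sᶜ := by
  obtain ⟨χ, hχ, rfl⟩ := h
  exact eqDefOver_of_defRel (P := fun a d => ¬ χ.formula.Holds a d) (DefPred.not χ.defRel)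
    χ.param hχ

theorem EqDefOver.biInter {ι : Type z} (I : Finset ι) {S : ι → Set (Tuple σ)}
    (h : ∀ i ∈ I, EqDefOver B (S i)) : EqDefOver B (⋂ i ∈ I, S i) := by
  classical
  induction I using Finset.induction_on with
  | empty => simpa using eqDefOver_univ
  | insert i I _ ih =>
    rw [Finset.set_biInter_insert]
    exact (h i (Finset.mem_insert_self i I)).inter
      (ih fun j hj => h j (Finset.mem_insert_of_mem hj))

/-- Since types are closed under negation, inclusion of complete types is equality. -/
theorem tp_eq_iff {a a' : Tuple σ} :
    tp a' B = tp a B ↔ ∀ S : Set (Tuple σ), EqDefOver B S → a ∈ S → a' ∈ S := by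
  constructor
  · rintro h _ ⟨χ, hχ, rfl⟩ ha
    have : χ ∈ tp a' B := h ▸ mem_tp.2 ⟨hχ, ha⟩
    exact this.2
  · intro h
    ext χ
    constructor
    · rintro ⟨hχ, ha'⟩
      refine ⟨hχ, ?_⟩
      by_contra ha
      exact h _ (EqDefOver.compl ⟨χ, hχ, rfl⟩) ha ha'
    · rintro ⟨hχ, ha⟩
      exact ⟨hχ, h _ ⟨χ, hχ, rfl⟩ ha⟩

theorem EqDefOver.exists_defFamily {S : Set (Tuple σ)} (h : EqDefOver B S) :
    ∃ D : (ParamVar B → M) → Set (Tuple σ), DefFamily D ∧ D (paramRep B) = S := by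
  obtain ⟨χ, hχ, rfl⟩ := h
  let g : RepVar χ.sorts → ParamVar B := fun p => ⟨⟨⟨χ.sorts p.1, χ.param p.1⟩, hχ p.1⟩, p.2⟩
  refine ⟨fun v => {a | χ.formula.Holds a (mkTuple χ.sorts fun q => v (g q))}, ?_, ?_⟩
  · exact χ.defRel.comp (fun q => Sum.inr q) (fun q => Sum.inl (g q))
  · have : (mkTuple χ.sorts fun q => paramRep B (g q)) = χ.param := by
      funext j
      exact Quotient.out_eq (s := (χ.sorts j).setoid) (χ.param j)
    show {a | χ.formula.Holds a (mkTuple χ.sorts fun q => paramRep B (g q))} = _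
    rw [this]
    rfl

/-- Compactness for the type of `a` over a small set `B`: it has realizations `mkTuple (w ∘ f j)`,
`j : J`, that satisfy the definable conditions `G`, provided that each formula of this type is
satisfied by tuples satisfying finitely many of these conditions. -/
theorem exists_realizations (hM : IsSaturated L M κ) (hκ : ℵ₀ < κ)
    (hB : #B < Cardinal.lift.{max u v} κ) (a : Tuple σ) {W : Type} [Countable W] {J : Type}
    (f : J → RepVar σ → W) {G : Set ((W → M) → Prop)} (hG : ∀ Q ∈ G, DefPred L Q)
    (h : ∀ S : Set (Tuple σ), EqDefOver B S → a ∈ S → ∀ G₀ : Finset ((W → M) → Prop),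
      (G₀ : Set _) ⊆ G →
      ∃ w : W → M, (∀ j, (mkTuple σ fun q => w (f j q)) ∈ S) ∧ ∀ Q ∈ G₀, Q w) :
    ∃ w : W → M, (∀ j, tp (mkTuple σ fun q => w (f j q)) B = tp a B) ∧ ∀ Q ∈ G, Q w := by
  classical
  let X := {S : Set (Tuple σ) // EqDefOver B S ∧ a ∈ S}
  choose D hD hDS using fun S : X => S.2.1.exists_defFamily
  let F₁ : X × J → (ParamVar B ⊕ W → M) → Prop := fun p u =>
    (mkTuple σ fun q => u (Sum.inr (f p.2 q))) ∈ D p.1 fun i => u (Sum.inl i)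
  let F₂ : ((W → M) → Prop) → (ParamVar B ⊕ W → M) → Prop := fun Q u => Q fun i => u (Sum.inr i)
  have key : ∀ (A₁ : Finset (X × J)) (A₂ : Finset ((W → M) → Prop)), (A₂ : Set _) ⊆ G →
      ∃ w : W → M, (∀ p ∈ A₁, F₁ p (Sum.elim (paramRep B) w)) ∧
        ∀ Q ∈ A₂, F₂ Q (Sum.elim (paramRep B) w) := by
    intro A₁ A₂ hA₂
    obtain ⟨w, hw, hw'⟩ := h (⋂ S ∈ A₁.image Prod.fst, S.1)
      (EqDefOver.biInter _ fun S _ => S.2.1) (Set.mem_iInter₂.2 fun S _ => S.2.2) A₂ hA₂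
    refine ⟨w, fun p hp => ?_, hw'⟩
    show _ ∈ D p.1 (paramRep B)
    rw [hDS]
    exact Set.mem_iInter₂.1 (hw p.2) p.1 (Finset.mem_image_of_mem _ hp)
  obtain ⟨w, hw⟩ := hM.exists_extension hκ.le (lift_mk_paramVar_lt hκ hB)
    (lift_mk_lt_of_countable (V := W) hκ) (F := Set.range F₁ ∪ F₂ '' G) (by
      rintro _ (⟨p, rfl⟩ | ⟨Q, hQ, rfl⟩)
      · exact DefPred.comp (hD p.1) (Sum.elim Sum.inl fun q => Sum.inr (f p.2 q))
      · exact (hG Q hQ).comp Sum.inr) (paramRep B) (by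
      intro F₀ hF₀
      obtain ⟨A₁, -, hA₁⟩ := Finset.subset_set_image_iff.1
        (show ((F₀.filter (· ∈ Set.range F₁) : Finset _) : Set _) ⊆ F₁ '' Set.univ from
          fun Q hQ => by
          rw [Set.image_univ]
          exact (Finset.mem_filter.1 hQ).2)
      obtain ⟨A₂, hA₂, hA₂'⟩ := Finset.subset_set_image_iff.1
        (show ((F₀.filter (· ∈ F₂ '' G) : Finset _) : Set _) ⊆ F₂ '' G from
          fun Q hQ => (Finset.mem_filter.1 hQ).2)
      obtain ⟨w, hw, hw'⟩ := key A₁ A₂ hA₂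
      refine ⟨w, fun Q hQ => ?_⟩
      rcases hF₀ hQ with hQ' | hQ'
      · obtain ⟨p, hp, rfl⟩ := Finset.mem_image.1 (hA₁ ▸ Finset.mem_filter.2 ⟨hQ, hQ'⟩)
        exact hw p hp
      · obtain ⟨p, hp, rfl⟩ := Finset.mem_image.1 (hA₂' ▸ Finset.mem_filter.2 ⟨hQ, hQ'⟩)
        exact hw' p hp)
  refine ⟨w, fun j => tp_eq_iff.2 fun S hS ha => ?_, fun Q hQ => ?_⟩
  · have := hw (F₁ (⟨S, hS, ha⟩, j)) (Or.inl ⟨_, rfl⟩)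
    have h2 : _ ∈ D ⟨S, hS, ha⟩ (paramRep B) := this
    rwa [hDS] at h2
  · exact hw (F₂ Q) (Or.inr ⟨Q, hQ, rfl⟩)

/-- If the realizations of the type of `a` over `B` give a `k`-inconsistent family, then so do the
solutions of some formula of this type. -/
theorem exists_eqDefOver_kInconsistent (hM : IsSaturated L M κ) (hκ : ℵ₀ < κ)
    (hB : #B < Cardinal.lift.{max u v} κ) {m k : ℕ} {τ : Fin m → EqSort L M} (δ : EqFormula σ τ)
    (a : Tuple τ) (h : KInconsistent δ {a' | tp a' B = tp a B} k) :
    ∃ S : Set (Tuple τ), EqDefOver B S ∧ a ∈ S ∧ KInconsistent δ S k := by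
  by_contra! hne
  obtain ⟨w, hw, hw'⟩ := exists_realizations hM hκ hB a
    (W := (Fin k × RepVar τ) ⊕ RepVar σ) (J := Fin k) (fun j q => Sum.inl (j, q))
    (G := Set.range (fun (p : {p : Fin k × Fin k // p.1 ≠ p.2}) w =>
        ¬ (mkTuple τ fun q => w (Sum.inl (p.1.1, q))) = mkTuple τ fun q => w (Sum.inl (p.1.2, q))) ∪
      Set.range fun (j : Fin k) w =>
        δ.Holds (mkTuple σ fun q => w (Sum.inr q)) (mkTuple τ fun q => w (Sum.inl (j, q))))
    (by
      rintro _ (⟨p, rfl⟩ | ⟨j, rfl⟩)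
      · exact defPred_pairwise_ne (fun j q => Sum.inl (j, q)) p.1
      · exact (defRel_holds δ).comp (fun q => Sum.inr q) (fun q => Sum.inl (j, q)))
    (by
      intro S hS ha G₀ hG₀
      have := hne S hS ha
      unfold KInconsistent at this
      push Not at this
      obtain ⟨a', hinj, ha', b, hb⟩ := this
      choose s hs using fun i => mkTuple_surjective τ (a' i)
      obtain ⟨r, rfl⟩ := mkTuple_surjective σ b
      refine ⟨Sum.elim (fun p => s p.1 p.2) r, fun j => ?_, fun Q hQ => ?_⟩
      · have := ha' j
        rwa [← hs j] at this
      · rcases hG₀ hQ with ⟨p, rfl⟩ | ⟨j, rfl⟩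
        · intro hp
          refine p.2 (hinj ?_)
          rw [← hs, ← hs]
          exact hp
        · have := hb j
          rwa [← hs j] at this)
  refine h (fun j => mkTuple τ fun q => w (Sum.inl (j, q))) ?_ hw
    ⟨mkTuple σ fun q => w (Sum.inr q), fun j => hw' _ (Or.inr ⟨j, rfl⟩)⟩
  intro i j hij
  by_contra hne'
  exact hw' _ (Or.inl ⟨⟨(i, j), hne'⟩, rfl⟩) hij

/-- A type all of whose formulas have infinitely many solutions has infinitely many realizations. -/
theorem infinite_realizations (hM : IsSaturated L M κ) (hκ : ℵ₀ < κ)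
    (hB : #B < Cardinal.lift.{max u v} κ) (a : Tuple σ)
    (h : ∀ S : Set (Tuple σ), EqDefOver B S → a ∈ S → S.Infinite) :
    {a' : Tuple σ | tp a' B = tp a B}.Infinite := by
  obtain ⟨w, hw, hw'⟩ := exists_realizations hM hκ hB a
    (W := ℕ × RepVar σ) (J := ℕ) (fun j q => (j, q))
    (G := Set.range (fun (p : {p : ℕ × ℕ // p.1 ≠ p.2}) w =>
        ¬ (mkTuple σ fun q => w (p.1.1, q)) = mkTuple σ fun q => w (p.1.2, q)))
    (by
      rintro _ ⟨p, rfl⟩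
      exact defPred_pairwise_ne (fun j q => (j, q)) p.1)
    (by
      intro S hS ha G₀ hG₀
      obtain ⟨s, hs, hs'⟩ := (infinite_iff_exists_reps S).1 (h S hS ha)
      refine ⟨s, hs', fun Q hQ => ?_⟩
      obtain ⟨p, rfl⟩ := hG₀ hQ
      exact hs p)
  exact (infinite_iff_exists_reps _).2 ⟨w, fun p => hw' _ ⟨p, rfl⟩, hw⟩

/-- A type-definable condition on a tuple and on parameters from `B` depends only on the type of the
tuple over `B`, up to the choice of representatives. -/
theorem TypeDefPred.exists_of_tp_eq (hM : IsSaturated L M κ) (hκ : ℵ₀ < κ) {J : Type} [Finite J]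
    {υ : J → EqSort L M} {P : (RepVar σ ⊕ RepVar υ → M) → Prop} (hP : TypeDefPred L P)
    {a a' : Tuple σ} {d : Tuple υ} (hd : ∀ j, (⟨υ j, d j⟩ : Imaginary L M) ∈ B)
    (htp : tp a' B = tp a B) {s : RepVar σ → M} {r : RepVar υ → M} (hs : mkTuple σ s = a)
    (hr : mkTuple υ r = d) (h : P (Sum.elim s r)) :
    ∃ s' r', mkTuple σ s' = a' ∧ mkTuple υ r' = d ∧ P (Sum.elim s' r') := by
  classical
  obtain ⟨F, hF, hPF⟩ := hP
  obtain ⟨s₀, rfl⟩ := mkTuple_surjective σ a'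
  let E : ((RepVar σ ⊕ RepVar υ) ⊕ (RepVar σ ⊕ RepVar υ) → M) → Prop := fun u =>
    (mkTuple σ fun q => u (Sum.inr (Sum.inl q))) = (mkTuple σ fun q => u (Sum.inl (Sum.inl q))) ∧
    (mkTuple υ fun q => u (Sum.inr (Sum.inr q))) = (mkTuple υ fun q => u (Sum.inl (Sum.inr q)))
  obtain ⟨w, hw⟩ := hM.exists_extension hκ.le
    (lift_mk_lt_of_countable (V := RepVar σ ⊕ RepVar υ) hκ)
    (lift_mk_lt_of_countable (V := RepVar σ ⊕ RepVar υ) hκ)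
    (F := {E} ∪ (fun Q u => Q fun i => u (Sum.inr i)) '' F) (by
      rintro _ (rfl | ⟨Q, hQ, rfl⟩)
      · exact DefPred.and
          (defPred_mkTuple_eq (fun q => Sum.inr (Sum.inl q)) (fun q => Sum.inl (Sum.inl q)))
          (defPred_mkTuple_eq (fun q => Sum.inr (Sum.inr q)) (fun q => Sum.inl (Sum.inr q)))
      · exact (hF Q hQ).comp Sum.inr) (Sum.elim s₀ r) (by
      intro F₀ hF₀
      obtain ⟨φ, hφ⟩ := DefPred.exists_formula (M := M) (L := L) (V := RepVar σ ⊕ RepVar υ)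
        (P := fun u => ∀ Q : {Q : F₀ // Q.1 ≠ E}, Q.1.1 (Sum.elim u u)) (by
          refine DefPred.forall_finite fun Q => ?_
          obtain ⟨Q', hQ', hQ⟩ := (hF₀ Q.1.2).resolve_left Q.2
          rw [← hQ]
          exact hF Q' hQ')
      have h1 : mkTuple σ s₀ ∈ {a | EqFormula.Holds (σ := σ) (τ := υ) φ a d} := by
        refine tp_eq_iff.1 htp _ (eqDefOver_of_defRel (defRel_holds _) d hd)
          ⟨s, r, hs, hr, (hφ _).2 fun Q => ?_⟩
        obtain ⟨Q', hQ', hQ⟩ := (hF₀ Q.1.2).resolve_left Q.2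
        rw [← hQ]
        exact (hPF _).1 h Q' hQ'
      obtain ⟨s', r', hs', hr', h'⟩ := h1
      refine ⟨Sum.elim s' r', fun Q hQ => ?_⟩
      by_cases hQE : Q = E
      · rw [hQE]
        exact ⟨hs', hr'.trans hr.symm⟩
      · have h3 := (hφ _).1 h' ⟨⟨Q, hQ⟩, hQE⟩
        obtain ⟨Q', hQ', rfl⟩ := (hF₀ hQ).resolve_left hQE
        exact h3)
  obtain ⟨h1, h2⟩ := hw E (Or.inl rfl)
  refine ⟨_, _, h1, h2.trans hr, (hPF _).2 fun Q hQ => ?_⟩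
  have := hw _ (Or.inr ⟨Q, hQ, rfl⟩)
  convert this using 1
  ext i
  cases i <;> rfl

end Types


/-! ### Coding finitely many pairs of formulas by one rank -/

section LocalCharacter

universe y z

variable {L : FirstOrder.Language.{u, v}} {M : Type w} [L.Structure M]

/-- Finitely many pairs of formulas `ψ i` in `x; y i` and `χ i` in `y i; z i` are coded by finite
sets `Δ`, `Θ` of formulas in `x; y` and `y; z` for a common `y`, the concatenation of the `y i`. In
the formula coding `χ i`, the part of `y` that does not belong to `y i` is fixed by further
parameters in `z`, which preserves both the infinity of the set of solutions and the
`k`-inconsistency. -/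
theorem exists_common_rank [Nonempty M] {n p : ℕ} {σ : Fin n → EqSort L M}
    (ψ : Fin p → ParamFormula σ) (χ : ∀ i, ParamFormula (ψ i).sorts) (k : Fin p → ℕ) :
    ∃ (m l : ℕ) (τ : Fin m → EqSort L M) (ζ : Fin l → EqSort L M) (Δ : Finset (EqFormula σ τ))
      (Θ : Finset (EqFormula τ ζ)) (K : ℕ), ∀ i,
      KInconsistent (ψ i).formula (χ i).solutions (k i) → ∀ (N : ℕ) (D : Set (Tuple σ)),
      {a | a ∈ (χ i).solutions ∧ RankGE (Δ : Set (EqFormula σ τ)) (Θ : Set (EqFormula τ ζ)) K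
        (N : Ordinal.{x}) (D ∩ {b | (ψ i).formula.Holds b a})}.Infinite →
      RankGE (Δ : Set (EqFormula σ τ)) (Θ : Set (EqFormula τ ζ)) K
        ((N + 1 : ℕ) : Ordinal.{x}) D := by
  classical
  let J := Σ i, Fin (ψ i).len
  let υ : J → EqSort L M := fun q => (ψ q.1).sorts q.2
  let J' := (Σ i, Fin (χ i).len) ⊕ J
  let υ' : J' → EqSort L M := Sum.elim (fun q => (χ q.1).sorts q.2) υ
  let d : Tuple υ' := fun q => Sum.rec (motive := fun q => (υ' q).Elem)
    (fun q => (χ q.1).param q.2) (fun q => (ψ q.1).param q.2) q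
  let e : Fin (Fintype.card J) ≃ J := (Fintype.equivFin J).symm
  let e' : Fin (Fintype.card J') ≃ J' := (Fintype.equivFin J').symm
  let τ := fun t => υ (e t)
  let ζ := fun t => υ' (e' t)
  have hδ : ∀ i, ∃ δ : EqFormula σ τ, ∀ b y, δ.Holds b y ↔
      (ψ i).formula.Holds b fun j => reindexTuple e υ y ⟨i, j⟩ := by
    intro i
    refine exists_eqFormula ?_
    unfold DefRel
    simp only [τ, reindexTuple_mkTuple]
    exact (ψ i).defRel.comp (fun q => Sum.inl q) fun q => Sum.inr
      ((Equiv.sigmaCongrLeft (β := fun j => Fin (υ j).arity) e).symm ⟨⟨i, q.1⟩, q.2⟩)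
  have hπ : ∀ i, ∃ π : EqFormula τ ζ, ∀ y z, π.Holds y z ↔
      (χ i).formula.Holds (fun j => reindexTuple e υ y ⟨i, j⟩)
        (fun j => reindexTuple e' υ' z (Sum.inl ⟨i, j⟩)) ∧
      ∀ q : {q : J // q.1 ≠ i},
        reindexTuple e υ y q.1 = (reindexTuple e' υ' z (Sum.inr q.1) : (υ q.1).Elem) := by
    intro i
    refine exists_eqFormula ?_
    unfold DefRel
    simp only [τ, ζ, reindexTuple_mkTuple]
    refine DefPred.and ?_ (DefPred.forall_finite fun q => ?_)
    · exact (χ i).defRel.comp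
        (fun q => Sum.inl
          ((Equiv.sigmaCongrLeft (β := fun j => Fin (υ j).arity) e).symm ⟨⟨i, q.1⟩, q.2⟩))
        (fun q => Sum.inr
          ((Equiv.sigmaCongrLeft (β := fun j => Fin (υ' j).arity) e').symm
            ⟨Sum.inl ⟨i, q.1⟩, q.2⟩))
    · exact defPred_mkTuple_apply_eq (σ := υ)
        (fun q => Sum.inl ((Equiv.sigmaCongrLeft (β := fun j => Fin (υ j).arity) e).symm q))
        (fun q => Sum.inr
          ((Equiv.sigmaCongrLeft (β := fun j => Fin (υ' j).arity) e').symm ⟨Sum.inr q.1, q.2⟩)) q.1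
  choose δ hδ using hδ
  choose π hπ using hπ
  refine ⟨_, _, τ, ζ, Finset.univ.image δ, Finset.univ.image π, Finset.univ.sup k, ?_⟩
  intro i hk N D hinf
  -- `full a` is the concatenation of the parameters of all `ψ i'`, with those of `ψ i` replaced
  -- by `a`.
  let full : Tuple (ψ i).sorts → Tuple υ :=
    fun a q => Function.update (fun i => (ψ i).param) i a q.1 q.2
  have hfull : ∀ a j, full a ⟨i, j⟩ = a j := fun a j => by simp [full]
  have hfull' : ∀ a (q : J), q.1 ≠ i → full a q = (ψ q.1).param q.2 := fun a q hq => by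
    simp [full, Function.update_of_ne hq]
  let g : Tuple (ψ i).sorts → Tuple τ := fun a t => full a (e t)
  have hg : ∀ a, reindexTuple e υ (g a) = full a := fun a => reindexTuple_apply e υ (full a)
  have hginj : Function.Injective g := by
    intro a a' haa
    have h1 : full a = full a' := by rw [← hg, ← hg, haa]
    funext j
    rw [← hfull a j, ← hfull a' j, h1]
  have hd : reindexTuple e' υ' (fun t => d (e' t)) = d := reindexTuple_apply e' υ' d
  refine rankGE_nat_succ.2 ⟨δ i, by simp, π i, by simp, fun t => d (e' t), ?_, ?_⟩
  · refine (hinf.image hginj.injOn).mono ?_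
    rintro _ ⟨a, ⟨haχ, haN⟩, rfl⟩
    refine ⟨(hπ i _ _).2 ⟨?_, fun q => ?_⟩, ?_⟩
    · simp only [hg, hfull, hd]
      exact haχ
    · rw [hg, hd, hfull' a q.1 q.2]
    · have : ∀ b, (δ i).Holds b (g a) ↔ (ψ i).formula.Holds b a := by
        intro b
        rw [hδ, hg]
        simp only [hfull]
      simpa only [this] using haN
  · intro a ha haπ
    rintro ⟨b, hb⟩
    have hle : k i ≤ Finset.univ.sup k := Finset.le_sup (Finset.mem_univ i)
    refine hk.mono le_rfl hle (fun t j => reindexTuple e υ (a t) ⟨i, j⟩) ?_ ?_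
      ⟨b, fun t => (hδ i _ _).1 (hb t)⟩
    · intro t t' htt
      refine ha ((reindexTuple e υ).injective ?_)
      funext q
      by_cases hq : q.1 = i
      · obtain ⟨i', j⟩ := q
        obtain rfl : i' = i := hq
        exact congrFun htt j
      · exact (((hπ i _ _).1 (haπ t)).2 ⟨q, hq⟩).trans (((hπ i _ _).1 (haπ t')).2 ⟨q, hq⟩).symm
    · intro t
      have := ((hπ i _ _).1 (haπ t)).1
      rw [hd] at this
      exact this

/-! ### Cardinality of the set of formulas -/

theorem aleph0_le_theoryCard : ℵ₀ ≤ theoryCard L := le_max_left _ _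

theorem mk_formula_le (α : Type) [Countable α] : #(L.Formula α) ≤ theoryCard L := by
  have h1 : #(L.Formula α) ≤ #(Σ n, L.BoundedFormula α n) :=
    Cardinal.mk_le_of_injective (f := fun φ => (⟨0, φ⟩ : Σ n, L.BoundedFormula α n))
      fun φ ψ h => by simpa using h
  refine h1.trans (BoundedFormula.card_le.trans (max_le aleph0_le_theoryCard ?_))
  refine Cardinal.add_le_of_le aleph0_le_theoryCard ?_ ?_
  · refine le_trans ?_ aleph0_le_theoryCard
    simp
  · rw [Cardinal.lift_uzero]
    exact le_max_right _ _

theorem mk_sigma_le_of_le {ι : Type y} {X : ι → Type (max y z)} {c : Cardinal.{max y z}}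
    (hc : ℵ₀ ≤ c) (hι : Cardinal.lift.{z} #ι ≤ c) (hX : ∀ i, #(X i) ≤ c) : #(Σ i, X i) ≤ c := by
  rw [Cardinal.mk_sigma]
  refine (Cardinal.sum_le_sum _ (fun _ => c) hX).trans ?_
  rw [Cardinal.sum_const, Cardinal.lift_umax.{y, z}, Cardinal.lift_id'.{y, max y z}]
  exact Cardinal.mul_le_of_le hc hι le_rfl

theorem mk_finset_le_of_le {X : Type z} {c : Cardinal.{z}} (hc : ℵ₀ ≤ c) (hX : #X ≤ c) :
    #(Finset X) ≤ c := by
  classical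
  exact (Cardinal.mk_le_of_surjective (f := List.toFinset) List.toFinset_surjective).trans
    ((Cardinal.mk_list_le_max X).trans (max_le hc hX))

theorem mk_fin_arrow_le_of_le {X : Type z} {c : Cardinal.{z}} (hc : ℵ₀ ≤ c) (hX : #X ≤ c) (n : ℕ) :
    #(Fin n → X) ≤ c :=
  (Cardinal.mk_le_of_injective (f := List.ofFn) List.ofFn_injective).trans
    ((Cardinal.mk_list_le_max X).trans (max_le hc hX))

theorem mk_eqSort_le : #(EqSort L M) ≤ theoryCard L := by
  refine (Cardinal.mk_le_of_injective
    (f := fun s : EqSort L M => (⟨s.arity, s.rel⟩ : Σ n : ℕ, L.Formula (Fin n ⊕ Fin n)))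
    ?_).trans ?_
  · rintro ⟨n, r, h⟩ ⟨n', r', h'⟩ heq
    obtain ⟨rfl, h2⟩ := Sigma.mk.inj heq
    obtain rfl := eq_of_heq h2
    rfl
  · exact mk_sigma_le_of_le.{0, max u v} aleph0_le_theoryCard
      (by simpa using aleph0_le_theoryCard) fun n => mk_formula_le _

/-- The data `Δ`, `Θ`, `k` of the ranks of formulas in the variables of sorts `σ`, with finite
tuples of variables `y`, `z`. -/
abbrev RankData {n : ℕ} (σ : Fin n → EqSort L M) : Type (max u v) :=
  Σ (m l : ℕ) (τ : Fin m → EqSort L M) (ζ : Fin l → EqSort L M),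
    Finset (EqFormula σ τ) × Finset (EqFormula τ ζ) × ℕ

theorem mk_rankData_le {n : ℕ} (σ : Fin n → EqSort L M) : #(RankData σ) ≤ theoryCard L := by
  have hc := aleph0_le_theoryCard (L := L)
  have hN : Cardinal.lift.{max u v} #ℕ ≤ theoryCard L := by simpa using hc
  have hF : ∀ k, Cardinal.lift.{max u v} #(Fin k → EqSort L M) ≤ theoryCard L := fun k => by
    rw [Cardinal.lift_id]
    exact mk_fin_arrow_le_of_le hc mk_eqSort_le k
  refine mk_sigma_le_of_le.{0, max u v} hc hN fun m =>
    mk_sigma_le_of_le.{0, max u v} hc hN fun l =>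
    mk_sigma_le_of_le.{max u v, max u v} hc (hF m) fun τ =>
    mk_sigma_le_of_le.{max u v, max u v} hc (hF l) fun ζ => ?_
  simp only [Cardinal.mk_prod, Cardinal.lift_id, Cardinal.lift_uzero]
  exact Cardinal.mul_le_of_le hc (mk_finset_le_of_le hc (mk_formula_le _))
    (Cardinal.mul_le_of_le hc (mk_finset_le_of_le hc (mk_formula_le _)) hN)

/-! ### Finite ranks imply local character -/

/-- A set of at most `|T|` elements, enlarged by finitely many, is small. -/
theorem mk_union_range_lt {κ : Cardinal.{w}} (hκ : Cardinal.lift.{w} (theoryCard L) <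
    Cardinal.lift.{max u v} κ) {A : Set (Imaginary L M)}
    (hA : #A ≤ Cardinal.lift.{w} (theoryCard L)) {m : ℕ} (c : Fin m → Imaginary L M) :
    #(A ∪ Set.range c : Set (Imaginary L M)) < Cardinal.lift.{max u v} κ := by
  have h0 : ℵ₀ ≤ Cardinal.lift.{w} (theoryCard L) := by
    simpa using aleph0_le_theoryCard (L := L)
  refine ((Cardinal.mk_union_le _ _).trans (Cardinal.add_le_of_le h0 hA ?_)).trans_lt hκ
  exact ((Set.finite_range c).lt_aleph0.le).trans h0

theorem tp_nonempty {n : ℕ} {σ : Fin n → EqSort L M} (b : Tuple σ) (A : Set (Imaginary L M)) :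
    (tp b A).Nonempty := by
  obtain ⟨χ, hχ, hχS⟩ := eqDefOver_univ (σ := σ) (B := A)
  exact ⟨χ, hχ, hχS ▸ Set.mem_univ b⟩

/-- A type contains a formula `θ` of minimal rank `N`. -/
theorem exists_min_rank {n m l : ℕ} {σ : Fin n → EqSort L M} {τ : Fin m → EqSort L M}
    {ζ : Fin l → EqSort L M} {Δ : Set (EqFormula σ τ)} {Θ : Set (EqFormula τ ζ)} {k : ℕ}
    (b : Tuple σ) (A : Set (Imaginary L M))
    (h : ∀ φ : ParamFormula σ, ∃ N : ℕ, ¬ RankGE Δ Θ k (N : Ordinal.{w}) φ.solutions) :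
    ∃ θ ∈ tp b A, ∃ N : ℕ, ¬ RankGE Δ Θ k ((N + 1 : ℕ) : Ordinal.{w}) θ.solutions ∧
      ∀ φ ∈ tp b A, RankGE Δ Θ k (N : Ordinal.{w}) φ.solutions := by
  classical
  have hex : ∃ N : ℕ, ∃ φ ∈ tp b A, ¬ RankGE Δ Θ k (N : Ordinal.{w}) φ.solutions := by
    obtain ⟨φ, hφ⟩ := tp_nonempty b A
    obtain ⟨N, hN⟩ := h φ
    exact ⟨N, φ, hφ, hN⟩
  obtain ⟨θ, hθ, hN⟩ := Nat.find_spec hex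
  have hmin := fun N => Nat.find_min hex (m := N)
  rcases hf : Nat.find hex with _ | N
  · rw [hf] at hN
    exact absurd (rankGE_nat_zero.2 ⟨b, hθ.2⟩) hN
  · rw [hf] at hN
    refine ⟨θ, hθ, N, hN, fun φ hφ => ?_⟩
    by_contra hne
    exact hmin N (by omega) ⟨φ, hφ, hne⟩

variable [Nonempty M] {κ : Cardinal.{w}}

/-- The rank of `θ ∧ ψ(x, a)` depends only on the type of `a` over any set that contains the
parameters of `θ`. -/
theorem rankGE_of_tp_eq (hM : IsSaturated L M κ) (hκ : ℵ₀ < κ) {n m l : ℕ}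
    {σ : Fin n → EqSort L M} {τ : Fin m → EqSort L M} {ζ : Fin l → EqSort L M}
    {Δ : Set (EqFormula σ τ)} {Θ : Set (EqFormula τ ζ)} (hΔ : Δ.Finite) (hΘ : Θ.Finite) {k N : ℕ}
    {B : Set (Imaginary L M)} {θ : ParamFormula σ} (hθ : θ.IsOver B) {p : ℕ}
    {υ : Fin p → EqSort L M} {ψ : EqFormula σ υ} {a a' : Tuple υ} (htp : tp a' B = tp a B)
    (h : RankGE Δ Θ k (N : Ordinal.{w}) (θ.solutions ∩ {b | ψ.Holds b a})) :
    RankGE Δ Θ k (N : Ordinal.{w}) (θ.solutions ∩ {b | ψ.Holds b a'}) := by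
  have hfam : DefFamily fun v : RepVar υ ⊕ RepVar θ.sorts → M =>
      {b | θ.formula.Holds b (mkTuple θ.sorts fun q => v (Sum.inr q))} ∩
        {b | ψ.Holds b (mkTuple υ fun q => v (Sum.inl q))} :=
    DefFamily.inter_holds (V := RepVar θ.sorts)
      (D := fun v => {b | θ.formula.Holds b (mkTuple θ.sorts fun q => v q)})
      (θ.defRel.comp (fun q => Sum.inr q) (fun q => Sum.inl q)) ψ Sum.inr Sum.inl
  obtain ⟨s, rfl⟩ := mkTuple_surjective υ a
  obtain ⟨r, hr⟩ := mkTuple_surjective θ.sorts θ.param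
  have htd := typeDefPred_rankGE hM hκ hΔ hΘ (k := k) N hfam
  obtain ⟨s', r', rfl, hr', h'⟩ := htd.exists_of_tp_eq hM hκ hθ htp rfl hr (by
    show RankGE Δ Θ k (N : Ordinal.{w}) ({b | θ.formula.Holds b (mkTuple θ.sorts r)} ∩
      {b | ψ.Holds b (mkTuple υ s)})
    rw [hr]
    exact h)
  have h2 : RankGE Δ Θ k (N : Ordinal.{w}) ({b | θ.formula.Holds b (mkTuple θ.sorts r')} ∩
      {b | ψ.Holds b (mkTuple υ s')}) := h'
  rw [hr'] at h2
  exact h2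

/-- If all ranks are finite, then `tp(b/A)` does not þ-fork over the set of parameters of its
formulas of minimal ranks. -/
theorem hasLocalCharacter_of_allRanksFinite (hM : IsSaturated L M κ) (hκ₀ : ℵ₀ < κ)
    (hκ : Cardinal.lift.{w} (theoryCard L) < Cardinal.lift.{max u v} κ)
    (hfin : AllRanksFinite L M) : HasLocalCharacter L M κ := by
  intro n σ b A _
  have hmin : ∀ t : RankData σ, ∃ θ ∈ tp b A, ∃ N : ℕ,
      ¬ RankGE (t.2.2.2.2.1 : Set (EqFormula σ t.2.2.1))
        (t.2.2.2.2.2.1 : Set (EqFormula t.2.2.1 t.2.2.2.1)) t.2.2.2.2.2.2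
        ((N + 1 : ℕ) : Ordinal.{w}) θ.solutions ∧
      ∀ φ ∈ tp b A, RankGE (t.2.2.2.2.1 : Set (EqFormula σ t.2.2.1))
        (t.2.2.2.2.2.1 : Set (EqFormula t.2.2.1 t.2.2.2.1)) t.2.2.2.2.2.2
        (N : Ordinal.{w}) φ.solutions := by
    rintro ⟨m, l, τ, ζ, Δ, Θ, k⟩
    exact exists_min_rank b A fun φ =>
      hfin n m (Fin l) σ τ ζ φ Δ Θ k Δ.finite_toSet Θ.finite_toSet
  choose θ hθ N hN hle using hmin
  let A₀ : Set (Imaginary L M) := Set.range fun q : Σ t : RankData σ, Fin (θ t).len =>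
    (⟨(θ q.1).sorts q.2, (θ q.1).param q.2⟩ : Imaginary L M)
  have hA₀ : #A₀ ≤ Cardinal.lift.{w} (theoryCard L) := by
    have h1 : #(Σ t : RankData σ, ULift.{max u v} (Fin (θ t).len)) ≤ theoryCard L :=
      mk_sigma_le_of_le.{max u v, max u v} aleph0_le_theoryCard
        (by rw [Cardinal.lift_id]; exact mk_rankData_le σ)
        fun t => (Cardinal.mk_le_aleph0).trans aleph0_le_theoryCard
    have h2 : #(Σ t : RankData σ, Fin (θ t).len) ≤ theoryCard L := by
      refine le_trans (Cardinal.mk_le_of_injective (f := fun q => ⟨q.1, ULift.up q.2⟩) ?_) h1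
      rintro ⟨t, i⟩ ⟨t', i'⟩ h
      obtain ⟨rfl, h3⟩ := Sigma.mk.inj h
      have := eq_of_heq h3
      simp only [ULift.up.injEq] at this
      rw [this]
    have h3 := Cardinal.mk_range_le_lift (f := fun q : Σ t : RankData σ, Fin (θ t).len =>
      (⟨(θ q.1).sorts q.2, (θ q.1).param q.2⟩ : Imaginary L M))
    rw [Cardinal.lift_id'.{max u v, max u v w}, Cardinal.lift_umax.{max u v, w}] at h3
    exact h3.trans (Cardinal.lift_le.2 h2)
  refine ⟨A₀, ?_, hA₀, ?_⟩
  · rintro _ ⟨q, rfl⟩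
    exact (hθ q.1).1 q.2
  rintro ⟨φ, hφ, p, ψ, hdiv, hcov⟩
  choose c' c hinf k hk using hdiv
  have hB : ∀ i, #(A₀ ∪ Set.range (c i) : Set (Imaginary L M)) < Cardinal.lift.{max u v} κ :=
    fun i => mk_union_range_lt hκ hA₀ (c i)
  choose S hS haS hkS using fun i =>
    exists_eqDefOver_kInconsistent hM hκ₀ (hB i) (ψ i).formula (ψ i).param (hk i)
  choose χ hχ hχS using hS
  obtain ⟨m, l, τ, ζ, Δ, Θ, K, hrank⟩ := exists_common_rank.{u, v, w, w} ψ χ k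
  let t : RankData σ := ⟨m, l, τ, ζ, Δ, Θ, K⟩
  -- The conjunction of `φ` with the formula of minimal rank still has this rank, so one of the
  -- disjuncts has it as well, and so have all its conjugates over `A₀ c`.
  obtain ⟨η, hη, hηS⟩ := EqDefOver.inter (B := A) ⟨θ t, (hθ t).1, rfl⟩ ⟨φ, hφ.1, rfl⟩
  have h1 := hle t η ⟨hη, hηS ▸ ⟨(hθ t).2, hφ.2⟩⟩
  rw [hηS] at h1
  have h2 : RankGE (Δ : Set (EqFormula σ τ)) (Θ : Set (EqFormula τ ζ)) K (N t : Ordinal.{w})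
      (⋃ i, (θ t).solutions ∩ (ψ i).solutions) := by
    refine RankGE.mono h1 ?_
    rw [← Set.inter_iUnion]
    exact Set.inter_subset_inter_right _ hcov
  obtain ⟨i, hi⟩ := h2.exists_of_iUnion
  refine hN t (hrank i (hχS i ▸ hkS i) (N t) _ ((hinf i).mono fun a' ha' => ⟨?_, ?_⟩))
  · rw [hχS]
    exact tp_eq_iff.1 ha' _ ⟨χ i, hχ i, hχS i⟩ (haS i)
  · exact rankGE_of_tp_eq hM hκ₀ Δ.finite_toSet Θ.finite_toSet
      (B := A₀ ∪ Set.range (c i)) (fun j => Or.inl ⟨⟨t, j⟩, rfl⟩) ha' hi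

end LocalCharacter


/-! ### Infinite ranks contradict local character -/

section Chain

universe y z

variable {L : FirstOrder.Language.{u, v}} {M : Type w} [L.Structure M]

section

variable {Λ : Type x} [LinearOrder Λ] {m l : ℕ} {τ : Fin m → EqSort L M} {ζ : Fin l → EqSort L M}

variable (τ ζ) in
/-- Variables for representatives of a tuple `c` and of the tuples `a j` for `j < i`. -/
abbrev PastVar (i : Λ) : Type x := {j : Λ // j < i} × RepVar τ ⊕ RepVar ζ

/-- The values of the variables `PastVar τ ζ i`. -/
def past (i : Λ) (α : Λ → RepVar τ → M) (r : RepVar ζ → M) : PastVar τ ζ i → M :=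
  Sum.elim (fun p => α p.1 p.2) r

/-- If the formula `φ` over `a j`, `j < i`, and `c` holds of `a i`, then it has infinitely many
solutions in `M^eq`. -/
def NonalgebraicFor (i : Λ) (φ : L.Formula (RepVar τ ⊕ PastVar τ ζ i)) (α : Λ → RepVar τ → M)
    (r : RepVar ζ → M) : Prop :=
  φ.Realize (Sum.elim (α i) (past i α r)) →
    {a | ∃ s, mkTuple τ s = a ∧ φ.Realize (Sum.elim s (past i α r))}.Infinite

theorem past_congr {i : Λ} {α α' : Λ → RepVar τ → M} (h : ∀ j < i, α j = α' j)
    (r : RepVar ζ → M) : past i α r = past i α' r := by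
  funext p
  rcases p with p | p
  · exact congrFun (h p.1.1 p.1.2) p.2
  · rfl

/-- If the rank of `D` is at least every `N < ω`, then there are chains indexed by any finite set `I`
which leave the rank of `D` at least `N`. Since each step offers infinitely many choices of `a i`,
finitely many algebraic formulas over the past can be avoided. -/
theorem exists_finite_chain [Nonempty M] {n : ℕ} {σ : Fin n → EqSort L M}
    {Δ : Set (EqFormula σ τ)} {Θ : Set (EqFormula τ ζ)} {k : ℕ} {D : Set (Tuple σ)}
    (hD : ∀ N : ℕ, RankGE Δ Θ k (N : Ordinal.{y}) D)
    {E : Set (Σ i : Λ, L.Formula (RepVar τ ⊕ PastVar τ ζ i))} (hE : E.Finite) (I : Finset Λ)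
    (N : ℕ) :
    ∃ (α : Λ → RepVar τ → M) (γ : Λ → RepVar ζ → M) (δ : Λ → EqFormula σ τ),
      (∀ i ∈ I, δ i ∈ Δ ∧ ∃ π ∈ Θ, π.Holds (mkTuple τ (α i)) (mkTuple ζ (γ i)) ∧
        KInconsistent (δ i) {a | π.Holds a (mkTuple ζ (γ i))} k) ∧
      (∀ e ∈ E, e.1 ∈ I → NonalgebraicFor e.1 e.2 α (γ e.1)) ∧
      RankGE Δ Θ k (N : Ordinal.{y}) (D ∩ {b | ∀ i ∈ I, (δ i).Holds b (mkTuple τ (α i))}) := by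
  classical
  induction I using Finset.induction_on_max generalizing N with
  | empty =>
    obtain ⟨δ, -⟩ := rankGE_nat_succ.1 (hD 1)
    exact ⟨fun _ _ => Classical.arbitrary M, fun _ _ => Classical.arbitrary M, fun _ => δ,
      by simp, by simp, by simpa using hD N⟩
  | insert i I hlt ih =>
    obtain ⟨α, γ, δ, hI, hEI, hrank⟩ := ih (N + 1)
    obtain ⟨δ', hδ', π, hπ, c, hinf, hk⟩ := rankGE_nat_succ.1 hrank
    obtain ⟨r, rfl⟩ := mkTuple_surjective ζ c
    -- The formulas of `E` with finitely many solutions exclude finitely many candidates for `a i`.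
    let sol : (Σ i : Λ, L.Formula (RepVar τ ⊕ PastVar τ ζ i)) → Set (Tuple τ) := fun e =>
      {a | ∃ s, mkTuple τ s = a ∧ e.2.Realize (Sum.elim s (past e.1 α r))}
    have hbad : (⋃ e ∈ {e ∈ E | (sol e).Finite}, sol e).Finite :=
      (hE.subset (Set.sep_subset _ _)).biUnion fun e he => he.2
    obtain ⟨a, ⟨haπ, ha⟩, habad⟩ := (hinf.sdiff hbad).nonempty
    obtain ⟨s, rfl⟩ := mkTuple_surjective τ a
    have hne : ∀ j ∈ I, j ≠ i := fun j hj => (hlt j hj).ne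
    have hpast : ∀ j ≤ i, ∀ r' : RepVar ζ → M,
        past j (Function.update α i s) r' = past j α r' := fun j hj r' =>
      past_congr (fun j' hj' => Function.update_of_ne (hj'.trans_le hj).ne _ _) r'
    refine ⟨Function.update α i s, Function.update γ i r, Function.update δ i δ', ?_, ?_, ?_⟩
    · intro j hj
      rcases Finset.mem_insert.1 hj with rfl | hj
      · simp only [Function.update_self]
        exact ⟨hδ', π, hπ, haπ, hk⟩
      · simp only [Function.update_of_ne (hne j hj)]
        exact hI j hj
    · rintro ⟨j, φ⟩ he hj
      rcases Finset.mem_insert.1 hj with hji | hj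
      · obtain rfl : j = i := hji
        simp only [NonalgebraicFor, Function.update_self, hpast j le_rfl]
        intro hφ hfin
        exact habad (Set.mem_biUnion (x := ⟨j, φ⟩) ⟨he, hfin⟩ ⟨s, rfl, hφ⟩)
      · simp only [NonalgebraicFor, Function.update_of_ne (hne j hj), hpast j (hlt j hj).le]
        exact hEI ⟨j, φ⟩ he hj
    · refine ha.mono fun b hb => ⟨hb.1.1, fun j hj => ?_⟩
      rcases Finset.mem_insert.1 hj with rfl | hj
      · simp only [Function.update_self]
        exact hb.2
      · simp only [Function.update_of_ne (hne j hj)]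
        exact hb.1.2 j hj

/-- Compactness turns the finite chains into a chain indexed by any small linear order `Λ`. -/
theorem exists_chain [Nonempty M] {κ : Cardinal.{w}} (hM : IsSaturated L M κ) (hκ : ℵ₀ < κ)
    (hΛ : Cardinal.lift.{w} #Λ < Cardinal.lift.{x} κ) {n : ℕ} {σ : Fin n → EqSort L M}
    {Δ : Set (EqFormula σ τ)} {Θ : Set (EqFormula τ ζ)} (hΔ : Δ.Finite) (hΘ : Θ.Finite) {k : ℕ}
    {D : Set (Tuple σ)} (hD : ∀ N : ℕ, RankGE Δ Θ k (N : Ordinal.{y}) D) :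
    ∃ (b : Tuple σ) (α : Λ → RepVar τ → M) (γ : Λ → RepVar ζ → M),
      (∀ i, ∃ δ ∈ Δ, ∃ π ∈ Θ, δ.Holds b (mkTuple τ (α i)) ∧
        π.Holds (mkTuple τ (α i)) (mkTuple ζ (γ i)) ∧
        KInconsistent δ {a | π.Holds a (mkTuple ζ (γ i))} k) ∧
      ∀ i φ, NonalgebraicFor i φ α (γ i) := by
  classical
  have := hΔ.to_subtype
  have := hΘ.to_subtype
  let W := RepVar σ ⊕ Λ × (RepVar τ ⊕ RepVar ζ)
  have hW : Cardinal.lift.{w} #W < Cardinal.lift.{x} κ := by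
    have hκ' : ℵ₀ < Cardinal.lift.{x} κ := by simpa using hκ
    have hle : ∀ (Y : Type) [Countable Y], Cardinal.lift.{max w x} #Y ≤ ℵ₀ := fun Y _ => by simp
    rw [Cardinal.mk_sum, Cardinal.mk_prod, Cardinal.lift_add]
    simp only [Cardinal.lift_mul]
    refine Cardinal.add_lt_of_lt hκ'.le ?_ (Cardinal.mul_lt_of_lt hκ'.le ?_ ?_)
    · simpa using (hle (RepVar σ)).trans_lt hκ'
    · simpa using hΛ
    · simpa using (hle (RepVar τ ⊕ RepVar ζ)).trans_lt hκ'
  let X := Λ ⊕ (Σ i : Λ, L.Formula (RepVar τ ⊕ PastVar τ ζ i) × ℕ)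
  let α' : (W → M) → Λ → RepVar τ → M := fun u i q => u (Sum.inr (i, Sum.inl q))
  let γ' : (W → M) → Λ → RepVar ζ → M := fun u i q => u (Sum.inr (i, Sum.inr q))
  let β' : (W → M) → Tuple σ := fun u => mkTuple σ fun q => u (Sum.inl q)
  -- `C₁` is the chain condition at `i`; `C₂ ⟨i, φ, t⟩` says that if `φ` holds of `a i`, then it has
  -- at least `t` solutions.
  let C₁ : Λ → (W → M) → Prop := fun i u => ∃ (δ : Δ) (π : Θ),
    δ.1.Holds (β' u) (mkTuple τ fun q => α' u i q) ∧
    π.1.Holds (mkTuple τ fun q => α' u i q) (mkTuple ζ fun q => γ' u i q) ∧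
    KInconsistent δ.1 {a | π.1.Holds a (mkTuple ζ fun q => γ' u i q)} k
  let C₂ : (Σ i : Λ, L.Formula (RepVar τ ⊕ PastVar τ ζ i) × ℕ) → (W → M) → Prop := fun e u =>
    e.2.1.Realize (Sum.elim (α' u e.1) (past e.1 (α' u) (γ' u e.1))) →
      ∃ s : Fin e.2.2 × RepVar τ → M,
        (∀ p : {p : Fin e.2.2 × Fin e.2.2 // p.1 ≠ p.2},
          ¬ (mkTuple τ fun q => s (p.1.1, q)) = mkTuple τ fun q => s (p.1.2, q)) ∧
        ∀ t, e.2.1.Realize (Sum.elim (fun q => s (t, q)) (past e.1 (α' u) (γ' u e.1)))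
  let toE : X → Σ i : Λ, L.Formula (RepVar τ ⊕ PastVar τ ζ i) :=
    Sum.elim (fun i => ⟨i, ⊥⟩) fun e => ⟨e.1, e.2.1⟩
  let F : X → (W → M) → Prop := Sum.elim C₁ C₂
  have hF : ∀ e, DefPred L (F e) := by
    rintro (i | ⟨i, φ, t⟩)
    · refine DefPred.exists_finite fun δ => DefPred.exists_finite fun π =>
        DefPred.and ?_ (DefPred.and ?_ ?_)
      · exact (defRel_holds δ.1).comp (fun q => Sum.inl q)
          (fun q => Sum.inr (i, Sum.inl q))
      · exact (defRel_holds π.1).comp (fun q => Sum.inr (i, Sum.inl q))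
          (fun q => Sum.inr (i, Sum.inr q))
      · exact defPred_kInconsistent δ.1 π.1 k (fun q => Sum.inr (i, Sum.inr q))
    · let g : PastVar τ ζ i → W := Sum.elim
        (fun p => Sum.inr (p.1.1, Sum.inl p.2))
        (fun q => Sum.inr (i, Sum.inr q))
      have hg : ∀ u, past i (α' u) (γ' u i) = fun p => u (g p) := by
        intro u
        funext p
        rcases p with p | p <;> rfl
      have hcomp : ∀ {U : Type x} (h : RepVar τ → U) (g : PastVar τ ζ i → U),
          DefPred L fun u : U → M => φ.Realize
            (Sum.elim (fun q => u (h q)) (fun p => u (g p))) := by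
        intro U h g
        refine ((DefPred.of_formula (M := M) φ).comp (Sum.elim h g)).congr fun u => ?_
        apply iff_of_eq
        congr 1
        ext j
        cases j <;> rfl
      show DefPred L (C₂ ⟨i, φ, t⟩)
      simp only [C₂, hg]
      refine DefPred.imp ?_ (DefPred.exists (DefPred.and ?_ ?_))
      · exact hcomp (fun q => Sum.inr (i, Sum.inl q)) g
      · exact DefPred.forall_finite fun p =>
          defPred_pairwise_ne (fun t q => Sum.inr (t, q)) p.1
      · exact DefPred.forall_finite fun t =>
          hcomp (fun q => Sum.inr (t, q)) (fun p => Sum.inl (g p))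
  obtain ⟨w, hw⟩ := hM.exists_valuation hW (F := F '' Set.univ) (P₀ := ∅) (by
      rintro _ ⟨e, -, rfl⟩
      exact hF e) (by
    intro F₀ hF₀ p hp
    obtain ⟨A, -, rfl⟩ := Finset.subset_set_image_iff.1 hF₀
    obtain ⟨α, γ, δ, hI, hE, hrank⟩ := exists_finite_chain hD
      (E := toE '' (A : Set X))
      (A.finite_toSet.image _) (A.image (Sum.elim id Sigma.fst)) 0
    obtain ⟨b, -, hb⟩ := hrank.nonempty
    obtain ⟨s, rfl⟩ := mkTuple_surjective σ b
    refine ⟨Sum.elim s fun p => Sum.elim (α p.1) (γ p.1) p.2, fun Q hQ => ?_,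
      fun q hq => (hp hq).elim⟩
    obtain ⟨e, he, rfl⟩ := Finset.mem_image.1 hQ
    have heI := Finset.mem_image_of_mem (Sum.elim id Sigma.fst) he
    rcases e with i | e
    · obtain ⟨hδ, π, hπ, h⟩ := hI i heI
      exact ⟨⟨δ i, hδ⟩, ⟨π, hπ⟩, hb i heI, h⟩
    · intro hφ
      have hinf := hE _ ⟨_, he, rfl⟩ heI hφ
      obtain ⟨s, hs, hs'⟩ := (infinite_iff_exists_reps _).1 hinf
      choose s' hs' hφs' using hs'
      refine ⟨fun p => s' p.1 p.2, fun p hp => ?_, fun t => hφs' t⟩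
      refine hs ⟨(p.1.1, p.1.2), fun h => p.2 (Fin.ext h)⟩ ?_
      rw [← hs', ← hs']
      exact hp)
  have hw' : ∀ e, F e w := fun e => hw.1 _ ⟨e, trivial, rfl⟩
  refine ⟨β' w, α' w, γ' w, fun i => ?_, fun i φ hφ => ?_⟩
  · obtain ⟨δ, π, h⟩ := hw' (Sum.inl i)
    exact ⟨δ.1, δ.2, π.1, π.2, h⟩
  · intro hfin
    obtain ⟨s, hs, hs'⟩ := hw' (Sum.inr ⟨i, φ, hfin.toFinset.card + 1⟩) hφ
    have := Finset.card_le_card_of_injOn (s := Finset.univ) (t := hfin.toFinset)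
      (fun t => mkTuple τ fun q => s (t, q))
      (fun t _ => hfin.mem_toFinset.2 ⟨_, rfl, hs' t⟩) (by
        intro t _ t' _ htt
        by_contra hne
        exact hs ⟨(t, t'), hne⟩ htt)
    simp at this

end

/-- In the initial ordinal of the successor of `|T|`, a set of at most `|T|` elements is bounded. -/
theorem exists_bound {ι : Type z} (h : Cardinal.lift.{max u v} #ι ≤
      Cardinal.lift.{z} (theoryCard L))
    (f : ι → (Order.succ (theoryCard L)).ord.ToType) : ∃ i, ∀ x, f x < i := by
  by_contra! hne
  have hcof : IsCofinal (Set.range f) := by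
    intro i
    obtain ⟨x, hx⟩ := hne i
    exact ⟨f x, ⟨x, rfl⟩, hx⟩
  have h1 := Order.cof_le hcof
  rw [Ordinal.cof_toType, (Cardinal.isRegular_succ aleph0_le_theoryCard).cof_ord] at h1
  have h2 : #(Set.range f) ≤ theoryCard L := by
    have := (Cardinal.mk_range_le_lift (f := f)).trans h
    exact Cardinal.lift_le.1 this
  exact (Order.lt_succ (theoryCard L)).not_ge (h1.trans h2)

variable [Nonempty M] {κ : Cardinal.{w}}

/-- If some rank is not smaller than `ω`, then there are `b` and a chain of length `|T|⁺` of
formulas `δ(x, a i)` satisfied by `b`, each of which strongly divides over the preceding `a j` and a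
finite tuple; then `tp(b / a)` þ-forks over all subsets of cardinality at most `|T|`. -/
theorem allRanksFinite_of_hasLocalCharacter (hM : IsSaturated L M κ) (hκ₀ : ℵ₀ < κ)
    (hκ : Cardinal.lift.{w} (Order.succ (theoryCard L)) < Cardinal.lift.{max u v} κ)
    (hLC : HasLocalCharacter L M κ) : AllRanksFinite L M := by
  intro n m ι σ τ ζ φ Δ Θ k hΔ hΘ
  by_contra hne
  push Not at hne
  obtain ⟨l, e, Θ', hΘ', hred⟩ := exists_finite_reduction hΘ
  let Λ := (Order.succ (theoryCard L)).ord.ToType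
  have hΛ : #Λ = Order.succ (theoryCard L) := Cardinal.mk_ord_toType _
  obtain ⟨b, α, γ, hδ, hnonalg⟩ :=
    exists_chain (Λ := Λ) hM hκ₀ (by rwa [hΛ]) hΔ hΘ'
      fun N => (hne N).of_reduction hred
  let a : Λ → Tuple τ := fun i => mkTuple τ (α i)
  let f : Λ × Fin m → Imaginary L M := fun p => ⟨τ p.2, a p.1 p.2⟩
  have hA : #(Set.range f) < Cardinal.lift.{max u v} κ := by
    have h1 : #(Λ × Fin m) ≤ Order.succ (theoryCard L) := by
      rw [Cardinal.mk_prod, hΛ]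
      have hc : ℵ₀ ≤ Order.succ (theoryCard L) := aleph0_le_theoryCard.trans (Order.le_succ _)
      refine Cardinal.mul_le_of_le hc (by simp) (le_trans ?_ hc)
      simp
    have h2 := Cardinal.mk_range_le_lift (f := f)
    rw [Cardinal.lift_id'.{max u v, max u v w}, Cardinal.lift_umax.{max u v, w}] at h2
    exact (h2.trans (Cardinal.lift_le.2 h1)).trans_lt hκ
  obtain ⟨A₀, hA₀, hA₀T, hfork⟩ := hLC n σ b (Set.range f) hA
  have hκ' : Cardinal.lift.{w} (theoryCard L) < Cardinal.lift.{max u v} κ :=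
    (Cardinal.lift_le.2 (Order.le_succ _)).trans_lt hκ
  choose idx hidx using fun x : A₀ => hA₀ x.2
  obtain ⟨i, hi⟩ := exists_bound (L := L) (ι := A₀) (by
    rw [Cardinal.lift_id'.{max u v, max u v w}, Cardinal.lift_umax.{max u v, w}]
    exact hA₀T) fun x => (idx x).1
  obtain ⟨δ, hδΔ, π, hπΘ, hδb, hπa, hk⟩ := hδ i
  let c : Fin l → Imaginary L M := fun t => ⟨ζ (e t), mkTuple (fun t => ζ (e t)) (γ i) t⟩
  let B : Set (Imaginary L M) := A₀ ∪ Set.range c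
  have hB : #B < Cardinal.lift.{max u v} κ := mk_union_range_lt hκ' hA₀T c
  -- Every element of `B` has representatives among the values of the variables `PastVar`.
  have hrep : ∀ x ∈ B, ∃ g : Fin x.1.arity → PastVar τ (fun t => ζ (e t)) i,
      Quotient.mk x.1.setoid (fun j => past i α (γ i) (g j)) = x.2 := by
    rintro x (hx | ⟨t, rfl⟩)
    · have h1 := hi ⟨x, hx⟩
      have h2 := hidx ⟨x, hx⟩
      generalize idx ⟨x, hx⟩ = p at h1 h2
      simp only at h2
      subst h2
      exact ⟨fun j => Sum.inl (⟨p.1, h1⟩, ⟨p.2, j⟩), rfl⟩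
    · exact ⟨fun j => Sum.inr ⟨t, j⟩, rfl⟩
  refine hfork ⟨⟨δ, a i⟩, ⟨fun j => ⟨(i, j), rfl⟩, hδb⟩, 1, fun _ => ⟨δ, a i⟩, fun _ => ?_, ?_⟩
  · refine ⟨l, c, ?_, k, ?_⟩
    · refine infinite_realizations hM hκ₀ hB (a i) ?_
      rintro _ ⟨χ, hχ, rfl⟩ ha
      choose g hg using fun j => hrep _ (hχ j)
      obtain ⟨ψ, hψ⟩ := (χ.defRel.comp (V := RepVar τ ⊕ PastVar τ (fun t => ζ (e t)) i)
        (fun q => Sum.inl q) (fun q => Sum.inr (g q.1 q.2))).exists_formula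
      have hparam : (mkTuple χ.sorts fun q => past i α (γ i) (g q.1 q.2)) = χ.param := funext hg
      have hψ' : ∀ s, ψ.Realize (Sum.elim s (past i α (γ i))) ↔ mkTuple τ s ∈ χ.solutions := by
        intro s
        rw [hψ]
        show χ.formula.Holds _ (mkTuple χ.sorts fun q => past i α (γ i) (g q.1 q.2)) ↔ _
        rw [hparam]
        rfl
      refine (hnonalg i ψ ((hψ' _).2 ha)).mono ?_
      rintro _ ⟨s, rfl, hs⟩
      exact (hψ' s).1 hs
    · refine hk.mono (fun a' ha' => ?_) le_rfl
      exact tp_eq_iff.1 ha' _ ⟨⟨π, mkTuple _ (γ i)⟩, fun t => Or.inr ⟨t, rfl⟩, rfl⟩ hπa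
  · exact fun x hx => Set.mem_iUnion.2 ⟨0, hx⟩

end Chain

end Thorn

theorem mainTheorem1 {L : FirstOrder.Language.{u, v}} (T : L.Theory) (hT : T.IsComplete)
    (M : Type w) [L.Structure M] [Nonempty M] [M ⊨ T]
    (κ : Cardinal.{w})
    (hκ : Cardinal.lift.{w} (Order.succ (Thorn.theoryCard L)) < Cardinal.lift.{max u v} κ)
    (hM : Thorn.IsSaturated L M κ) :
    (Thorn.IsRosy L M ↔ Thorn.HasLocalCharacter L M κ) ∧
      (Thorn.IsRosy L M ↔ Thorn.AllRanksFinite L M) := by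
  have hlt : Cardinal.lift.{w} (Thorn.theoryCard L) < Cardinal.lift.{max u v} κ :=
    (Cardinal.lift_le.2 (Order.le_succ _)).trans_lt hκ
  have hκ₀ : ℵ₀ < κ := by
    have h0 : ℵ₀ ≤ Cardinal.lift.{w} (Thorn.theoryCard L) := by
      simpa using Thorn.aleph0_le_theoryCard (L := L)
    simpa using h0.trans_lt hlt
  have hfin : Thorn.IsRosy L M ↔ Thorn.AllRanksFinite L M :=
    ⟨Thorn.allRanksFinite_of_isRosy hM hκ₀, Thorn.isRosy_of_allRanksFinite⟩
  exact ⟨hfin.trans ⟨Thorn.hasLocalCharacter_of_allRanksFinite hM hκ₀ hlt,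
    Thorn.allRanksFinite_of_hasLocalCharacter hM hκ₀ hκ⟩, hfin⟩
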